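/- **Theorem.** Let $M$ be a smooth Riemannian manifold of dimension $m=2+p$ ($p\ge 0$) with metric $\bar g$, Christoffel symbols $\bar\Gamma^i_{jk}$ and curvature $\bar R$, where $R(X,Y)Z=\nabla_X\nabla_YZ-\nabla_Y\nabla_XZ-\nabla_{[X,Y]}Z$. Let $\Sigma$ be a smooth surface mapped into $M$ by a smooth immersion (for instance an embedding). Fix local coordinates $u^1,u^2$ on $\Sigma$ and $x^1,\dots,x^m$ on $M$; regard the $x^i$ as functions on $\Sigma$, and put $e_a=(\partial_ax^i)\partial_i$, $g_{ab}=\bar g(e_a,e_b)$, $g=\det(g_{ab})$ (repeated indices are summed). Let $N_1,\dots,N_p$ be a smooth local frame of normal vector fields along $\Sigma$ with $\bar g(N_A,N_B)=\delta_{AB}$ and $\bar g(N_A,e_a)=0$, and let $n_A^i$ be the components of $N_A$. Let $K=g\big(R(e_1,e_2)e_2,e_1\big)/\big(g_{11}g_{22}-g_{12}^2\big)$ be the Gaussian curvature of $\Sigma$, where $R$ is the curvature of the induced metric $g_{ab}$. Let $h_{A,ab}=\bar g(\bar\nabla_{e_a}e_b,N_A)$ be the second fundamental form, let $W_A$, with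 $(W_A)^a_b=g^{ac}h_{A,cb}$, be the Weingarten maps, and let $H=\frac12\sum_{A=1}^p(\operatorname{tr}W_A)N_A$ be the mean curvature vector. Let $\rho$ be a smooth non-vanishing density on $\Sigma$, that is, an object given in each coordinate system by a non-vanishing smooth function and transforming by $\tilde\rho(v)=\left|\frac{\partial(u^1,u^2)}{\partial(v^1,v^2)}\right|\rho(u(v))$. Set $$\{f,h\}=\frac1\rho\big((\partial_1f)(\partial_2h)-(\partial_2f)(\partial_1h)\big),\qquad \mathcal P^{ij}=\{x^i,x^j\},\qquad \mathcal S_A^{ij}=\{x^i,n_A^j\}+\{x^i,x^k\}\bar\Gamma^j_{kl}n_A^l .$$ Regard $\mathcal P$ and $\mathcal S_A$ as maps $TM\to TM$ by $\mathcal P(X)=\mathcal P^{ik}\bar g_{kj}X^j\partial_i$ and $\mathcal S_A(X)=\mathcal S_A^{ik}\bar g_{kj}X^j\partial_i$, put $\mathcal B_A=\mathcal P\mathcal S_A$, and let $\operatorname{Tr}$ denote the trace over $TM$. Then, at every point of $\Sigma$ at which the coordinates and the normal frame are defined, $$K=\frac1g\,\bar g\big(\bar R(e_1,e_2)e_2,e_1\big)-\frac{\rho^2}{2g}\sum_{A=1}^p\operatorname{Tr}\mathcal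 S_A^2,\qquad H=\frac{\rho^2}{2g}\sum_{A=1}^p(\operatorname{Tr}\mathcal B_A)N_A .$$ In particular, when $M=\mathbb R^m$ with the Euclidean metric and the $x^i$ are the Cartesian coordinates, $$K=-\frac{\rho^2}{2g}\sum_{A=1}^p\sum_{i,j=1}^m\{x^i,n_A^j\}\{x^j,n_A^i\},\qquad H=\frac{\rho^2}{2g}\sum_{A=1}^p\sum_{i,j,k=1}^m\{x^i,x^j\}\{x^j,n_A^i\}\,n_A^k\,\partial_k .$$ -/

import Mathlib

open scoped Manifold ContDiff

noncomputable section

namespace SurfaceCurvature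

/-- The coordinate space `ℝⁿ`. -/
abbrev Euc (n : ℕ) : Type := EuclideanSpace ℝ (Fin n)

/-- The partial derivative `∂_a F` at `y`. -/
def pderiv {n : ℕ} (a : Fin n) (F : Euc n → ℝ) (y : Euc n) : ℝ :=
  fderiv ℝ F y (EuclideanSpace.single a 1)

/-! ### Levi-Civita connection and curvature of a metric given in coordinates -/

/-- The Christoffel symbol `Γ^i_{jk}` at `y` of the metric with components `G`. -/
def christoffel {n : ℕ} (G : Euc n → Matrix (Fin n) (Fin n) ℝ) (i j k : Fin n) (y : Euc n) : ℝ :=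
  (1 / 2) * ∑ l, (G y)⁻¹ i l *
    (pderiv j (fun z => G z l k) y + pderiv k (fun z => G z l j) y - pderiv l (fun z => G z j k) y)

/-- The component `R^l_{kij}` at `y` of the Riemann curvature tensor
`R(X,Y)Z = ∇_X ∇_Y Z - ∇_Y ∇_X Z - ∇_[X,Y] Z`, that is, `R(∂_i,∂_j)∂_k = ∑ l, R^l_{kij} ∂_l`. -/
def riemann {n : ℕ} (G : Euc n → Matrix (Fin n) (Fin n) ℝ) (l k i j : Fin n) (y : Euc n) : ℝ :=
  pderiv i (christoffel G l j k) y - pderiv j (christoffel G l i k) y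
    + ∑ q, (christoffel G l i q y * christoffel G q j k y
        - christoffel G l j q y * christoffel G q i k y)

/-- `G(R(X,Y)Z, V)` at `y`, for tangent vectors given by their components. -/
def curvatureForm {n : ℕ} (G : Euc n → Matrix (Fin n) (Fin n) ℝ) (y : Euc n)
    (X Y Z V : Fin n → ℝ) : ℝ :=
  ∑ q, ∑ l, ∑ k, ∑ i, ∑ j, G y l q * riemann G l k i j y * X i * Y j * Z k * V q

/-! ### Metrics in charts -/

section Geometry

variable {m p : ℕ} {r : ℕ∞ω}
  {S : Type*} [TopologicalSpace S] [ChartedSpace (Euc 2) S]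
  {M : Type*} [TopologicalSpace M] [ChartedSpace (Euc m) M] [IsManifold (𝓡 m) ∞ M]

/-- The components `ḡ_{ij}` of the metric of `M` in the chart `ψ`, as functions on the chart's
image; the `i`-th coordinate vector at `ψ⁻¹ y` is the image of the `i`-th basis vector under the
differential of `ψ⁻¹`. -/
def ambientMetric
    (gbar : Bundle.ContMDiffRiemannianMetric (𝓡 m) r (Euc m)
      (fun x : M => TangentSpace (𝓡 m) x))
    (ψ : OpenPartialHomeomorph M (Euc m)) (y : Euc m) : Matrix (Fin m) (Fin m) ℝ :=
  Matrix.of fun i j => gbar.inner (ψ.symm y)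
    (mfderiv (𝓡 m) (𝓡 m) ψ.symm y (EuclideanSpace.single i 1 : Euc m))
    (mfderiv (𝓡 m) (𝓡 m) ψ.symm y (EuclideanSpace.single j 1 : Euc m))

/-- The vector `e_a`, tangent to the image of `f`, at the point with coordinates `u` in the
chart `φ` of the surface. -/
def tangentBasis (f : S → M) (φ : OpenPartialHomeomorph S (Euc 2)) (a : Fin 2) (u : Euc 2) :
    TangentSpace (𝓡 m) (f (φ.symm u)) :=
  mfderiv (𝓡 2) (𝓡 m) (fun v => f (φ.symm v)) u (EuclideanSpace.single a 1 : Euc 2)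

/-- The components `g_{ab} = ḡ(e_a, e_b)` of the induced metric of the surface in the chart `φ`. -/
def inducedMetric
    (gbar : Bundle.ContMDiffRiemannianMetric (𝓡 m) r (Euc m)
      (fun x : M => TangentSpace (𝓡 m) x))
    (f : S → M) (φ : OpenPartialHomeomorph S (Euc 2)) (u : Euc 2) : Matrix (Fin 2) (Fin 2) ℝ :=
  Matrix.of fun a b => gbar.inner (f (φ.symm u)) (tangentBasis f φ a u) (tangentBasis f φ b u)

/-- The Gaussian curvature of the surface at `s`: the sectional curvature of the induced metric
in the plane spanned by the coordinate vectors of the chart `φ`. -/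
def gaussianCurvature
    (gbar : Bundle.ContMDiffRiemannianMetric (𝓡 m) r (Euc m)
      (fun x : M => TangentSpace (𝓡 m) x))
    (f : S → M) (φ : OpenPartialHomeomorph S (Euc 2)) (s : S) : ℝ :=
  curvatureForm (inducedMetric gbar f φ) (φ s)
      (Pi.single 0 1) (Pi.single 1 1) (Pi.single 1 1) (Pi.single 0 1)
    / (inducedMetric gbar f φ (φ s) 0 0 * inducedMetric gbar f φ (φ s) 1 1
        - inducedMetric gbar f φ (φ s) 0 1 ^ 2)

/-! ### Normal frames and the mean curvature vector -/

/-- `N 0, …, N (p-1)` is, over the set `U`, a smooth orthonormal frame of vector fields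
along `f` which are normal to the surface. -/
structure IsNormalFrame
    (gbar : Bundle.ContMDiffRiemannianMetric (𝓡 m) r (Euc m)
      (fun x : M => TangentSpace (𝓡 m) x))
    (f : S → M) (U : Set S) (N : Fin p → ∀ s : S, TangentSpace (𝓡 m) (f s)) : Prop where
  smooth : ∀ A, ContMDiffOn (𝓡 2) ((𝓡 m).prod (𝓡 m)) ∞
    (fun s => (⟨f s, N A s⟩ : Bundle.TotalSpace (Euc m) (fun x : M => TangentSpace (𝓡 m) x))) U
  orthonormal : ∀ s ∈ U, ∀ A B, gbar.inner (f s) (N A s) (N B s) = if A = B then 1 else 0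
  normal : ∀ s ∈ U, ∀ A, ∀ v : TangentSpace (𝓡 2) s,
    gbar.inner (f s) (N A s) (mfderiv (𝓡 2) (𝓡 m) f s v) = 0

/-- The embedding coordinate `xⁱ` as a function on the surface. -/
def xCoord (f : S → M) (ψ : OpenPartialHomeomorph M (Euc m)) (i : Fin m) (s : S) : ℝ :=
  ψ (f s) i

/-- The component `n_A^i` of the normal vector `N A` in the chart `ψ`, as a function on the
surface. -/
def nCoord (f : S → M) (ψ : OpenPartialHomeomorph M (Euc m))
    (N : Fin p → ∀ s : S, TangentSpace (𝓡 m) (f s)) (A : Fin p) (i : Fin m) (s : S) : ℝ :=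
  WithLp.ofLp (p := 2) (V := Fin m → ℝ) (mfderiv (𝓡 m) (𝓡 m) ψ (f s) (N A s)) i

/-- The partial derivative `∂_a F` at `s`, in the chart `φ`, of a function `F` on the surface. -/
def surfDeriv (φ : OpenPartialHomeomorph S (Euc 2)) (a : Fin 2) (F : S → ℝ) (s : S) : ℝ :=
  pderiv a (fun u => F (φ.symm u)) (φ s)

/-- The component `i`, in the chart `ψ`, of the ambient covariant derivative of the tangent field
`e_b` in the direction `e_a`: `∂_a ∂_b xⁱ + Γ̄^i_{jk} ∂_a x^j ∂_b x^k`. -/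
def covDerivTangent
    (gbar : Bundle.ContMDiffRiemannianMetric (𝓡 m) r (Euc m)
      (fun x : M => TangentSpace (𝓡 m) x))
    (f : S → M) (φ : OpenPartialHomeomorph S (Euc 2)) (ψ : OpenPartialHomeomorph M (Euc m))
    (a b : Fin 2) (i : Fin m) (s : S) : ℝ :=
  surfDeriv φ a (surfDeriv φ b (xCoord f ψ i)) s
    + ∑ j, ∑ k, christoffel (ambientMetric gbar ψ) i j k (ψ (f s))
        * surfDeriv φ a (xCoord f ψ j) s * surfDeriv φ b (xCoord f ψ k) s

/-- The second fundamental form `h_{A,ab}`: the coefficient along `N A` of the ambient covariant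
derivative of `e_b` in the direction `e_a`. -/
def secondFundamentalForm
    (gbar : Bundle.ContMDiffRiemannianMetric (𝓡 m) r (Euc m)
      (fun x : M => TangentSpace (𝓡 m) x))
    (f : S → M) (N : Fin p → ∀ s : S, TangentSpace (𝓡 m) (f s))
    (φ : OpenPartialHomeomorph S (Euc 2)) (ψ : OpenPartialHomeomorph M (Euc m))
    (A : Fin p) (s : S) : Matrix (Fin 2) (Fin 2) ℝ :=
  Matrix.of fun a b => ∑ i, ∑ j, ambientMetric gbar ψ (ψ (f s)) i j
    * covDerivTangent gbar f φ ψ a b i s * nCoord f ψ N A j s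

/-- The Weingarten map `(W_A)^a_b = g^{ac} h_{A,cb}`. -/
def weingarten
    (gbar : Bundle.ContMDiffRiemannianMetric (𝓡 m) r (Euc m)
      (fun x : M => TangentSpace (𝓡 m) x))
    (f : S → M) (N : Fin p → ∀ s : S, TangentSpace (𝓡 m) (f s))
    (φ : OpenPartialHomeomorph S (Euc 2)) (ψ : OpenPartialHomeomorph M (Euc m))
    (A : Fin p) (s : S) : Matrix (Fin 2) (Fin 2) ℝ :=
  (inducedMetric gbar f φ (φ s))⁻¹ * secondFundamentalForm gbar f N φ ψ A s

/-- The mean curvature vector `H = (1/2) ∑ A, (tr W_A) N_A`. -/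
def meanCurvatureVector
    (gbar : Bundle.ContMDiffRiemannianMetric (𝓡 m) r (Euc m)
      (fun x : M => TangentSpace (𝓡 m) x))
    (f : S → M) (N : Fin p → ∀ s : S, TangentSpace (𝓡 m) (f s))
    (φ : OpenPartialHomeomorph S (Euc 2)) (ψ : OpenPartialHomeomorph M (Euc m))
    (s : S) : TangentSpace (𝓡 m) (f s) :=
  (1 / 2 : ℝ) • ∑ A, (weingarten gbar f N φ ψ A s).trace • N A s

/-! ### Densities, the Poisson bracket, and the maps built from it -/

variable (S) in
/-- A smooth non-vanishing density on a surface: a function `coord φ` on the image of every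
chart `φ`, transforming with the absolute value of the Jacobian determinant. -/
structure Density where
  coord : OpenPartialHomeomorph S (Euc 2) → Euc 2 → ℝ
  smooth : ∀ φ ∈ IsManifold.maximalAtlas (𝓡 2) ∞ S, ContDiffOn ℝ ∞ (coord φ) φ.target
  ne_zero : ∀ φ ∈ IsManifold.maximalAtlas (𝓡 2) ∞ S, ∀ u ∈ φ.target, coord φ u ≠ 0
  transform : ∀ φ ∈ IsManifold.maximalAtlas (𝓡 2) ∞ S,
    ∀ φ' ∈ IsManifold.maximalAtlas (𝓡 2) ∞ S, ∀ s ∈ φ.source ∩ φ'.source,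
      coord φ' (φ' s)
        = |(fderiv ℝ (fun v => φ (φ'.symm v)) (φ' s)).det| * coord φ (φ s)

/-- The Poisson bracket `{F, F'} = (1/ρ) ε^{ab} (∂_a F) (∂_b F')`, computed in the chart `φ`. -/
def bracket (ρ : Density S) (φ : OpenPartialHomeomorph S (Euc 2)) (F F' : S → ℝ) (s : S) : ℝ :=
  1 / ρ.coord φ (φ s)
    * (surfDeriv φ 0 F s * surfDeriv φ 1 F' s - surfDeriv φ 1 F s * surfDeriv φ 0 F' s)

/-- The tensor `𝒫^{ij} = {xⁱ, xʲ}`. -/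
def tensorP (ρ : Density S) (f : S → M)
    (φ : OpenPartialHomeomorph S (Euc 2)) (ψ : OpenPartialHomeomorph M (Euc m)) (s : S) :
    Matrix (Fin m) (Fin m) ℝ :=
  Matrix.of fun i j => bracket ρ φ (xCoord f ψ i) (xCoord f ψ j) s

/-- The tensor `𝒮_A^{ij} = {xⁱ, n_A^j} + {xⁱ, xᵏ} Γ̄^j_{kl} n_A^l`. -/
def tensorS
    (gbar : Bundle.ContMDiffRiemannianMetric (𝓡 m) r (Euc m)
      (fun x : M => TangentSpace (𝓡 m) x))
    (ρ : Density S) (f : S → M) (N : Fin p → ∀ s : S, TangentSpace (𝓡 m) (f s))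
    (φ : OpenPartialHomeomorph S (Euc 2)) (ψ : OpenPartialHomeomorph M (Euc m))
    (A : Fin p) (s : S) : Matrix (Fin m) (Fin m) ℝ :=
  Matrix.of fun i j => bracket ρ φ (xCoord f ψ i) (nCoord f ψ N A j) s
    + ∑ k, ∑ l, bracket ρ φ (xCoord f ψ i) (xCoord f ψ k) s
        * christoffel (ambientMetric gbar ψ) j k l (ψ (f s)) * nCoord f ψ N A l s

/-- The map `𝒫 : TM → TM`, `𝒫(X)^i = 𝒫^{ik} ḡ_{kj} X^j`, as a matrix. -/
def mapP
    (gbar : Bundle.ContMDiffRiemannianMetric (𝓡 m) r (Euc m)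
      (fun x : M => TangentSpace (𝓡 m) x))
    (ρ : Density S) (f : S → M)
    (φ : OpenPartialHomeomorph S (Euc 2)) (ψ : OpenPartialHomeomorph M (Euc m)) (s : S) :
    Matrix (Fin m) (Fin m) ℝ :=
  tensorP ρ f φ ψ s * ambientMetric gbar ψ (ψ (f s))

/-- The map `𝒮_A : TM → TM`, `𝒮_A(X)^i = 𝒮_A^{ik} ḡ_{kj} X^j`, as a matrix. -/
def mapS
    (gbar : Bundle.ContMDiffRiemannianMetric (𝓡 m) r (Euc m)
      (fun x : M => TangentSpace (𝓡 m) x))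
    (ρ : Density S) (f : S → M) (N : Fin p → ∀ s : S, TangentSpace (𝓡 m) (f s))
    (φ : OpenPartialHomeomorph S (Euc 2)) (ψ : OpenPartialHomeomorph M (Euc m))
    (A : Fin p) (s : S) : Matrix (Fin m) (Fin m) ℝ :=
  tensorS gbar ρ f N φ ψ A s * ambientMetric gbar ψ (ψ (f s))

/-- The map `ℬ_A = 𝒫 𝒮_A`. -/
def mapB
    (gbar : Bundle.ContMDiffRiemannianMetric (𝓡 m) r (Euc m)
      (fun x : M => TangentSpace (𝓡 m) x))
    (ρ : Density S) (f : S → M) (N : Fin p → ∀ s : S, TangentSpace (𝓡 m) (f s))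
    (φ : OpenPartialHomeomorph S (Euc 2)) (ψ : OpenPartialHomeomorph M (Euc m))
    (A : Fin p) (s : S) : Matrix (Fin m) (Fin m) ℝ :=
  mapP gbar ρ f φ ψ s * mapS gbar ρ f N φ ψ A s

end Geometry

/-- The Euclidean metric of `ℝᵐ`. -/
abbrev flatMetric (m : ℕ) : Bundle.ContMDiffRiemannianMetric (𝓡 m) ω (Euc m)
    (fun x : Euc m => TangentSpace (𝓡 m) x) :=
  riemannianMetricVectorSpace (Euc m)

end SurfaceCurvature

end

noncomputable section

namespace SurfaceCurvature
open Matrix Filter Topology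

/-! ### Calculus of partial derivatives -/

section Calculus
variable {n m : ℕ} {a b : Fin n} {F H : Euc n → ℝ} {y : Euc n}

/-! In charts the surface becomes a map `X` from an open set of the plane to ℝⁿ, and the ambient
metric a matrix function `G`. Write D_a for the covariant derivative along `X`, e_a for the partial
derivatives of `X`, and ⟨ , ⟩ for the form `G` at `X`. Three properties of D_a suffice: it is
compatible with the metric (`pderiv_form`), it is torsion free (`covDeriv_velocity_comm`), and its
commutator is the ambient curvature (`covDeriv_covDeriv`, `curvature_connMatrix`).

The two tensors are bivectors: 𝒫 = (1/ρ)(e_0 ⊗ e_1 - e_1 ⊗ e_0) and 𝒮_A = (1/ρ)(e_0 ⊗ D_1 N_A - e_1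
⊗ D_0 N_A), the Christoffel term of 𝒮_A being what completes the derivative of N_A (`tensorP_eq`,
`tensorS_eq`). The trace of a product of bivectors depends only on pairings of their entries, and
⟨D_a N_A, e_b⟩ = -h_{A,ab} by `weingarten_equation`. Hence Tr 𝒮_A² = -(2/ρ²) det h_A and Tr ℬ_A =
(g/ρ²) tr W_A. The second identity is the formula for H; the first turns the formula for K into the
Gauss equation.

For `gauss_equation`, compatibility writes ⟨R̄(e_0, e_1)e_1, e_0⟩ through derivatives of the
functions ⟨D_a e_b, e_c⟩ and products ⟨D_a e_b, D_c e_d⟩ (`curvatureForm_velocity`). Splitting the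
products along the frame (e, N) by `form_eq_of_frame` leaves -∑ det h_A plus terms in ⟨D_a e_b,
e_c⟩, which the Koszul formula expresses by the induced metric alone. These terms need not be
recognised by hand as the intrinsic curvature: the same equation for `X = id`, with no normals, does
it (`curvatureForm_eq_curvatureFirst`). -/

theorem pderiv_congr (h : F =ᶠ[𝓝 y] H) : pderiv a F y = pderiv a H y := by
  simp only [pderiv, h.fderiv_eq]

theorem contDiffAt_pderiv (hF : ContDiffAt ℝ ∞ F y) : ContDiffAt ℝ ∞ (pderiv a F) y :=
  (hF.fderiv_right (m := ∞) (by simp)).clm_apply contDiffAt_const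

theorem differentiableAt_of_smooth {E : Type*} [NormedAddCommGroup E] [NormedSpace ℝ E]
    {F : Euc n → E} (hF : ContDiffAt ℝ ∞ F y) : DifferentiableAt ℝ F y :=
  hF.differentiableAt (by simp)

theorem pderiv_add (hF : ContDiffAt ℝ ∞ F y) (hH : ContDiffAt ℝ ∞ H y) :
    pderiv a (fun z => F z + H z) y = pderiv a F y + pderiv a H y := by
  simp only [pderiv]
  rw [fderiv_fun_add (differentiableAt_of_smooth hF) (differentiableAt_of_smooth hH)]
  rfl

theorem pderiv_mul (hF : ContDiffAt ℝ ∞ F y) (hH : ContDiffAt ℝ ∞ H y) :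
    pderiv a (fun z => F z * H z) y = pderiv a F y * H y + F y * pderiv a H y := by
  simp only [pderiv]
  rw [fderiv_fun_mul (differentiableAt_of_smooth hF) (differentiableAt_of_smooth hH)]
  simp; ring

theorem pderiv_sum {ι : Type*} {s : Finset ι} {F : ι → Euc n → ℝ}
    (hF : ∀ i, ContDiffAt ℝ ∞ (F i) y) :
    pderiv a (fun z => ∑ i ∈ s, F i z) y = ∑ i ∈ s, pderiv a (F i) y := by
  simp only [pderiv]
  rw [fderiv_fun_sum fun i _ => differentiableAt_of_smooth (hF i)]
  simp

theorem pderiv_const (c : ℝ) : pderiv a (fun _ => c) y = 0 := by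
  simp [pderiv]

theorem pderiv_comm (hF : ContDiffAt ℝ ∞ F y) :
    pderiv a (pderiv b F) y = pderiv b (pderiv a F) y := by
  have hd : DifferentiableAt ℝ (fderiv ℝ F) y :=
    differentiableAt_of_smooth (hF.fderiv_right (m := ∞) (by simp))
  have hs := hF.isSymmSndFDerivAt (by simpa using ENat.LEInfty.out)
  have key : ∀ v w, fderiv ℝ (fun z => fderiv ℝ F z v) y w = fderiv ℝ (fderiv ℝ F) y w v := by
    intro v w
    rw [fderiv_clm_apply hd (differentiableAt_const v)]
    simp
  change fderiv ℝ (fun z => fderiv ℝ F z _) y _ = fderiv ℝ (fun z => fderiv ℝ F z _) y _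
  rw [key, key]
  exact hs _ _

theorem sum_smul_single (v : Euc n) : v = ∑ j, v j • (EuclideanSpace.single j 1 : Euc n) := by
  ext i
  simp [Finset.sum_apply, Pi.single_apply]

theorem pderiv_comp {H : Euc m → ℝ} {X : Euc n → Euc m}
    (hH : ContDiffAt ℝ ∞ H (X y)) (hX : ContDiffAt ℝ ∞ X y) :
    pderiv a (fun z => H (X z)) y
      = ∑ j, pderiv j H (X y) * pderiv a (fun z => X z j) y := by
  have hX' := differentiableAt_of_smooth hX
  have h1 : ∀ j, pderiv a (fun z => X z j) y
      = fderiv ℝ X y (EuclideanSpace.single a 1) j := by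
    intro j
    have := ((EuclideanSpace.proj (𝕜 := ℝ) j).hasFDerivAt (x := X y)).comp y hX'.hasFDerivAt
    simp only [pderiv]
    have h2 : fderiv ℝ (fun z => X z j) y = _ := this.fderiv
    rw [h2]; rfl
  simp only [h1]
  have := (differentiableAt_of_smooth hH).hasFDerivAt.comp y hX'.hasFDerivAt
  have h2 : fderiv ℝ (fun z => H (X z)) y = _ := this.fderiv
  simp only [pderiv]
  rw [h2, ContinuousLinearMap.comp_apply]
  conv_lhs => rw [sum_smul_single (fderiv ℝ X y (EuclideanSpace.single a 1))]
  rw [map_sum]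
  refine Finset.sum_congr rfl fun j _ => ?_
  rw [map_smul, smul_eq_mul, mul_comm]

theorem contDiffAt_coord {X : Euc n → Euc m} (hX : ContDiffAt ℝ ∞ X y) (i : Fin m) :
    ContDiffAt ℝ ∞ (fun z => X z i) y :=
  (EuclideanSpace.proj (𝕜 := ℝ) i).contDiff.contDiffAt.comp y hX

theorem contDiffAt_det {k : ℕ} {G : Euc n → Matrix (Fin k) (Fin k) ℝ}
    (hG : ∀ i j, ContDiffAt ℝ ∞ (fun z => G z i j) y) :
    ContDiffAt ℝ ∞ (fun z => (G z).det) y := by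
  simp only [Matrix.det_apply]
  refine ContDiffAt.sum fun σ _ => ?_
  exact (contDiffAt_prod fun i _ => hG _ _).const_smul _

/-- By Cramer's rule the entries are quotients of determinants in the entries of `G` and constants.
-/
theorem contDiffAt_inv {k : ℕ} {G : Euc n → Matrix (Fin k) (Fin k) ℝ}
    (hG : ∀ i j, ContDiffAt ℝ ∞ (fun z => G z i j) y) (h0 : (G y).det ≠ 0) (i j : Fin k) :
    ContDiffAt ℝ ∞ (fun z => (G z)⁻¹ i j) y := by
  simp only [Matrix.inv_def, Matrix.smul_apply, Ring.inverse_eq_inv', smul_eq_mul,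
    Matrix.adjugate_apply]
  refine ((contDiffAt_det hG).inv h0).mul (contDiffAt_det fun p q => ?_)
  by_cases h : p = j
  · subst h; simpa using contDiffAt_const
  · simpa [Matrix.updateRow_apply, h] using hG p q

theorem contDiffAt_christoffel {G : Euc n → Matrix (Fin n) (Fin n) ℝ}
    (hG : ∀ i j, ContDiffAt ℝ ∞ (fun z => G z i j) y) (h0 : (G y).det ≠ 0) (i j k : Fin n) :
    ContDiffAt ℝ ∞ (christoffel G i j k) y := by
  unfold christoffel
  refine contDiffAt_const.mul (ContDiffAt.sum fun l _ => ?_)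
  exact (contDiffAt_inv hG h0 _ _).mul
    (((contDiffAt_pderiv (hG _ _)).add (contDiffAt_pderiv (hG _ _))).sub
      (contDiffAt_pderiv (hG _ _)))

end Calculus

/-! ### The Levi-Civita connection -/

section Connection
variable {n : ℕ} {G : Euc n → Matrix (Fin n) (Fin n) ℝ}

theorem christoffel_symm (hs : ∀ y, (G y).IsSymm) (i j k : Fin n) (y : Euc n) :
    christoffel G i j k y = christoffel G i k j y := by
  have h' : ∀ l, pderiv l (fun z => G z j k) y = pderiv l (fun z => G z k j) y := by
    intro l
    have h : (fun z => G z j k) = fun z => G z k j := funext fun z => (hs z).apply _ _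
    rw [h]
  simp only [christoffel]
  congr 1
  refine Finset.sum_congr rfl fun l _ => ?_
  rw [h' l]; ring

/-- Lowering the index cancels the inverse metric in the definition and leaves the symbol of the
first kind. -/
theorem metric_mul_christoffel {y : Euc n} (h0 : (G y).det ≠ 0) (l j k : Fin n) :
    ∑ i, G y l i * christoffel G i j k y
      = (1 / 2) * (pderiv j (fun z => G z l k) y + pderiv k (fun z => G z l j) y
          - pderiv l (fun z => G z j k) y) := by
  set c : Fin n → ℝ := fun l => (1 / 2) * (pderiv j (fun z => G z l k) y
    + pderiv k (fun z => G z l j) y - pderiv l (fun z => G z j k) y) with hc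
  have h1 : (fun i => christoffel G i j k y) = (G y)⁻¹ *ᵥ c := by
    ext i
    simp only [christoffel, mulVec, dotProduct, hc, Finset.mul_sum]
    refine Finset.sum_congr rfl fun q _ => ?_
    ring
  have h2 : G y *ᵥ (fun i => christoffel G i j k y) = c := by
    rw [h1, mulVec_mulVec, Matrix.mul_nonsing_inv _ (isUnit_iff_ne_zero.mpr h0), one_mulVec]
  exact congrFun h2 l

/-- The metric is parallel: in the sum of the two first-kind symbols every derivative but the wanted
one cancels, by symmetry of `G`. -/
theorem pderiv_metric (hs : ∀ y, (G y).IsSymm) {y : Euc n} (h0 : (G y).det ≠ 0)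
    (c i j : Fin n) :
    pderiv c (fun z => G z i j) y
      = ∑ l, G y l j * christoffel G l c i y + ∑ l, G y i l * christoffel G l c j y := by
  have hsw : ∀ i j, (fun z => G z i j) = fun z => G z j i :=
    fun i j => funext fun z => (hs z).apply _ _
  have h1 : ∑ l, G y l j * christoffel G l c i y = ∑ l, G y j l * christoffel G l c i y :=
    Finset.sum_congr rfl fun l _ => by rw [(hs y).apply]
  rw [h1, metric_mul_christoffel h0, metric_mul_christoffel h0, hsw j i, hsw j c, hsw i c]
  ring

end Connection

/-! ### Vector fields along a map -/

section VectorCalculus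
variable {k n : ℕ} {a : Fin k} {u : Euc k}

/-- The componentwise partial derivative of a vector-valued function. -/
def pderivVec (a : Fin k) (Z : Euc k → Fin n → ℝ) (u : Euc k) : Fin n → ℝ :=
  fun i => pderiv a (fun v => Z v i) u

/-- The componentwise partial derivative of a matrix-valued function. -/
def pderivMat (a : Fin k) (B : Euc k → Matrix (Fin n) (Fin n) ℝ) (u : Euc k) :
    Matrix (Fin n) (Fin n) ℝ :=
  Matrix.of fun i j => pderiv a (fun v => B v i j) u

theorem contDiffAt_mulVec {B : Euc k → Matrix (Fin n) (Fin n) ℝ} {Z : Euc k → Fin n → ℝ}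
    (hB : ∀ i j, ContDiffAt ℝ ∞ (fun v => B v i j) u)
    (hZ : ∀ i, ContDiffAt ℝ ∞ (fun v => Z v i) u) (i : Fin n) :
    ContDiffAt ℝ ∞ (fun v => (B v *ᵥ Z v) i) u := by
  simp only [mulVec, dotProduct]
  exact ContDiffAt.sum fun j _ => (hB i j).mul (hZ j)

theorem contDiffAt_dotProduct {Y Z : Euc k → Fin n → ℝ}
    (hY : ∀ i, ContDiffAt ℝ ∞ (fun v => Y v i) u)
    (hZ : ∀ i, ContDiffAt ℝ ∞ (fun v => Z v i) u) :
    ContDiffAt ℝ ∞ (fun v => Y v ⬝ᵥ Z v) u := by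
  simp only [dotProduct]
  exact ContDiffAt.sum fun j _ => (hY j).mul (hZ j)

theorem pderiv_dotProduct {Y Z : Euc k → Fin n → ℝ}
    (hY : ∀ i, ContDiffAt ℝ ∞ (fun v => Y v i) u)
    (hZ : ∀ i, ContDiffAt ℝ ∞ (fun v => Z v i) u) :
    pderiv a (fun v => Y v ⬝ᵥ Z v) u = pderivVec a Y u ⬝ᵥ Z u + Y u ⬝ᵥ pderivVec a Z u := by
  simp only [dotProduct, pderivVec]
  rw [pderiv_sum fun i => (hY i).mul (hZ i), ← Finset.sum_add_distrib]
  exact Finset.sum_congr rfl fun i _ => pderiv_mul (hY i) (hZ i)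

theorem pderivVec_mulVec {B : Euc k → Matrix (Fin n) (Fin n) ℝ} {Z : Euc k → Fin n → ℝ}
    (hB : ∀ i j, ContDiffAt ℝ ∞ (fun v => B v i j) u)
    (hZ : ∀ i, ContDiffAt ℝ ∞ (fun v => Z v i) u) :
    pderivVec a (fun v => B v *ᵥ Z v) u
      = pderivMat a B u *ᵥ Z u + B u *ᵥ pderivVec a Z u := by
  ext i
  exact pderiv_dotProduct (fun j => hB i j) hZ

theorem pderivVec_add {Y Z : Euc k → Fin n → ℝ}
    (hY : ∀ i, ContDiffAt ℝ ∞ (fun v => Y v i) u)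
    (hZ : ∀ i, ContDiffAt ℝ ∞ (fun v => Z v i) u) :
    pderivVec a (fun v => Y v + Z v) u = pderivVec a Y u + pderivVec a Z u := by
  ext i
  exact pderiv_add (hY i) (hZ i)

end VectorCalculus

/-! ### Covariant differentiation along a parametrised surface -/

section Along
variable {n : ℕ} {G : Euc n → Matrix (Fin n) (Fin n) ℝ} {X : Euc 2 → Euc n} {V : Set (Euc 2)}
  {u : Euc 2}

/-- The components of the coordinate vector field `∂_a X`. -/
def velocity (X : Euc 2 → Euc n) (a : Fin 2) : Euc 2 → Fin n → ℝ :=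
  pderivVec a fun v i => X v i

/-- The matrix of the connection form along `X` in the direction `a`. -/
def connMatrix (G : Euc n → Matrix (Fin n) (Fin n) ℝ) (X : Euc 2 → Euc n) (a : Fin 2)
    (u : Euc 2) : Matrix (Fin n) (Fin n) ℝ :=
  Matrix.of fun i k => ∑ j, christoffel G i j k (X u) * velocity X a u j

/-- The covariant derivative, in the direction `a`, of a vector field along `X`. -/
def covDeriv (G : Euc n → Matrix (Fin n) (Fin n) ℝ) (X : Euc 2 → Euc n) (a : Fin 2)
    (Z : Euc 2 → Fin n → ℝ) (u : Euc 2) : Fin n → ℝ :=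
  pderivVec a Z u + connMatrix G X a u *ᵥ Z u

/-- The first fundamental form of `X`. -/
def gram (G : Euc n → Matrix (Fin n) (Fin n) ℝ) (X : Euc 2 → Euc n) (u : Euc 2) :
    Matrix (Fin 2) (Fin 2) ℝ :=
  Matrix.of fun a b => velocity X a u ⬝ᵥ G (X u) *ᵥ velocity X b u

/-- `X` is smooth on the open set `V`, and `G` is symmetric, and smooth and nondegenerate along
`X`. -/
structure IsMetricAlong (G : Euc n → Matrix (Fin n) (Fin n) ℝ) (X : Euc 2 → Euc n)
    (V : Set (Euc 2)) : Prop where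
  isOpen : IsOpen V
  symm : ∀ y, (G y).IsSymm
  smooth : ∀ u ∈ V, ContDiffAt ℝ ∞ X u
  smooth_metric : ∀ u ∈ V, ∀ i j, ContDiffAt ℝ ∞ (fun y => G y i j) (X u)
  det_ne_zero : ∀ u ∈ V, (G (X u)).det ≠ 0

theorem form_comm {A : Matrix (Fin n) (Fin n) ℝ} (hA : A.IsSymm) (v w : Fin n → ℝ) :
    v ⬝ᵥ A *ᵥ w = w ⬝ᵥ A *ᵥ v := by
  rw [dotProduct_mulVec, dotProduct_comm, ← mulVec_transpose, hA.eq]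

namespace IsMetricAlong

variable (h : IsMetricAlong G X V) (hu : u ∈ V)
include h hu

theorem contDiffAt_velocity (a : Fin 2) (i : Fin n) :
    ContDiffAt ℝ ∞ (fun v => velocity X a v i) u :=
  contDiffAt_pderiv (contDiffAt_coord (h.smooth u hu) i)

theorem contDiffAt_connMatrix (a : Fin 2) (i j : Fin n) :
    ContDiffAt ℝ ∞ (fun v => connMatrix G X a v i j) u := by
  simp only [connMatrix, Matrix.of_apply]
  exact ContDiffAt.sum fun l _ => ((contDiffAt_christoffel (h.smooth_metric u hu)
    (h.det_ne_zero u hu) i l j).comp u (h.smooth u hu)).mul (h.contDiffAt_velocity hu a l)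

theorem contDiffAt_metric (i j : Fin n) : ContDiffAt ℝ ∞ (fun v => G (X v) i j) u :=
  (h.smooth_metric u hu i j).comp u (h.smooth u hu)

theorem contDiffAt_covDeriv {Z : Euc 2 → Fin n → ℝ}
    (hZ : ∀ i, ContDiffAt ℝ ∞ (fun v => Z v i) u) (a : Fin 2) (i : Fin n) :
    ContDiffAt ℝ ∞ (fun v => covDeriv G X a Z v i) u :=
  (contDiffAt_pderiv (hZ i)).add (contDiffAt_mulVec (h.contDiffAt_connMatrix hu a) hZ i)

theorem contDiffAt_form {Y Z : Euc 2 → Fin n → ℝ}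
    (hY : ∀ i, ContDiffAt ℝ ∞ (fun v => Y v i) u)
    (hZ : ∀ i, ContDiffAt ℝ ∞ (fun v => Z v i) u) :
    ContDiffAt ℝ ∞ (fun v => Y v ⬝ᵥ G (X v) *ᵥ Z v) u :=
  contDiffAt_dotProduct hY (contDiffAt_mulVec (h.contDiffAt_metric hu) hZ)

/-- This is `pderiv_metric` pulled back by the chain rule; it is the input for compatibility along
`X`. -/
theorem pderivMat_metric (a : Fin 2) :
    pderivMat a (fun v => G (X v)) u
      = (connMatrix G X a u)ᵀ * G (X u) + G (X u) * connMatrix G X a u := by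
  ext i j
  simp only [pderivMat, Matrix.of_apply, Matrix.add_apply, Matrix.mul_apply, Matrix.transpose_apply,
    connMatrix]
  rw [pderiv_comp (h.smooth_metric u hu i j) (h.smooth u hu)]
  simp only [pderiv_metric h.symm (h.det_ne_zero u hu), add_mul, Finset.sum_add_distrib,
    Finset.sum_mul, Finset.mul_sum]
  congr 1
  · rw [Finset.sum_comm]
    refine Finset.sum_congr rfl fun l _ => Finset.sum_congr rfl fun c _ => ?_
    simp only [velocity, pderivVec]; ring
  · rw [Finset.sum_comm]
    refine Finset.sum_congr rfl fun l _ => Finset.sum_congr rfl fun c _ => ?_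
    simp only [velocity, pderivVec]; ring

/-- The connection is compatible with the metric. -/
theorem pderiv_form {Y Z : Euc 2 → Fin n → ℝ}
    (hY : ∀ i, ContDiffAt ℝ ∞ (fun v => Y v i) u)
    (hZ : ∀ i, ContDiffAt ℝ ∞ (fun v => Z v i) u) (a : Fin 2) :
    pderiv a (fun v => Y v ⬝ᵥ G (X v) *ᵥ Z v) u
      = covDeriv G X a Y u ⬝ᵥ G (X u) *ᵥ Z u + Y u ⬝ᵥ G (X u) *ᵥ covDeriv G X a Z u := by
  have hG := h.contDiffAt_metric hu
  rw [pderiv_dotProduct hY (contDiffAt_mulVec hG hZ), pderivVec_mulVec hG hZ,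
    h.pderivMat_metric hu]
  simp only [covDeriv, add_dotProduct, dotProduct_add, mulVec_add, add_mulVec, ← mulVec_mulVec]
  -- The transposed connection matrix moves across the pairing and acts on `Y`, completing its
  -- covariant derivative.
  rw [mulVec_transpose, ← dotProduct_comm (_ ᵥ* _), ← dotProduct_mulVec,
    dotProduct_comm _ (connMatrix G X a u *ᵥ Y u)]
  ring

/-- The connection is torsion free. -/
theorem covDeriv_velocity_comm (a b : Fin 2) :
    covDeriv G X a (velocity X b) u = covDeriv G X b (velocity X a) u := by
  ext i
  simp only [covDeriv, Pi.add_apply]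
  congr 1
  · exact pderiv_comm (contDiffAt_coord (h.smooth u hu) i)
  · simp only [connMatrix, mulVec, dotProduct, Matrix.of_apply, Finset.sum_mul]
    rw [Finset.sum_comm]
    refine Finset.sum_congr rfl fun j _ => Finset.sum_congr rfl fun l _ => ?_
    rw [christoffel_symm h.symm]; ring

/-- The second derivatives of `Z` and the mixed first-order terms are symmetric in `a` and `b`, so
only the curvature matrix of the connection acts on `Z`. -/
theorem covDeriv_covDeriv {Z : Euc 2 → Fin n → ℝ}
    (hZ : ∀ i, ContDiffAt ℝ ∞ (fun v => Z v i) u) (a b : Fin 2) :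
    covDeriv G X a (covDeriv G X b Z) u - covDeriv G X b (covDeriv G X a Z) u
      = (pderivMat a (connMatrix G X b) u - pderivMat b (connMatrix G X a) u
          + connMatrix G X a u * connMatrix G X b u - connMatrix G X b u * connMatrix G X a u)
        *ᵥ Z u := by
  have key : ∀ a b : Fin 2, covDeriv G X a (covDeriv G X b Z) u
      = pderivVec a (pderivVec b Z) u + pderivMat a (connMatrix G X b) u *ᵥ Z u
        + connMatrix G X b u *ᵥ pderivVec a Z u + connMatrix G X a u *ᵥ pderivVec b Z u
        + (connMatrix G X a u * connMatrix G X b u) *ᵥ Z u := by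
    intro a b
    have h1 : pderivVec a (covDeriv G X b Z) u = pderivVec a (pderivVec b Z) u
        + (pderivMat a (connMatrix G X b) u *ᵥ Z u
          + connMatrix G X b u *ᵥ pderivVec a Z u) := by
      rw [← pderivVec_mulVec (h.contDiffAt_connMatrix hu b) hZ]
      exact pderivVec_add (fun i => contDiffAt_pderiv (hZ i))
        (contDiffAt_mulVec (h.contDiffAt_connMatrix hu b) hZ)
    rw [covDeriv, h1, covDeriv, mulVec_add, mulVec_mulVec]
    abel
  have hc : pderivVec a (pderivVec b Z) u = pderivVec b (pderivVec a Z) u := by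
    ext i
    exact pderiv_comm (hZ i)
  rw [key, key, hc]
  simp only [sub_mulVec, add_mulVec]
  abel

/-- The chain rule on the Christoffel symbols along `X` gives their derivatives; the terms with
second derivatives of `X` cancel because partial derivatives commute. -/
theorem curvature_connMatrix (a b : Fin 2) (l k : Fin n) :
    (pderivMat a (connMatrix G X b) u - pderivMat b (connMatrix G X a) u
        + connMatrix G X a u * connMatrix G X b u - connMatrix G X b u * connMatrix G X a u) l k
      = ∑ i, ∑ j, riemann G l k i j (X u) * velocity X a u i * velocity X b u j := by
  have hΓ := contDiffAt_christoffel (h.smooth_metric u hu) (h.det_ne_zero u hu)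
  have hΓX : ∀ i j k, ContDiffAt ℝ ∞ (fun v => christoffel G i j k (X v)) u :=
    fun i j k => (hΓ i j k).comp u (h.smooth u hu)
  have key : ∀ a b : Fin 2, pderivMat a (connMatrix G X b) u l k
      = (∑ i, ∑ j, pderiv i (christoffel G l j k) (X u) * velocity X a u i * velocity X b u j)
        + ∑ j, christoffel G l j k (X u) * pderiv a (fun v => velocity X b v j) u := by
    intro a b
    have h1 : ∀ j, pderiv a (fun v => christoffel G l j k (X v) * velocity X b v j) u
        = (∑ i, pderiv i (christoffel G l j k) (X u) * velocity X a u i * velocity X b u j)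
          + christoffel G l j k (X u) * pderiv a (fun v => velocity X b v j) u := by
      intro j
      rw [pderiv_mul (hΓX l j k) (h.contDiffAt_velocity hu b j),
        pderiv_comp (hΓ l j k) (h.smooth u hu), Finset.sum_mul]
      rfl
    simp only [pderivMat, connMatrix, Matrix.of_apply]
    rw [pderiv_sum fun j => (hΓX l j k).mul (h.contDiffAt_velocity hu b j)]
    simp only [h1, Finset.sum_add_distrib]
    rw [Finset.sum_comm]
  have hc : ∀ j, pderiv a (fun v => velocity X b v j) u = pderiv b (fun v => velocity X a v j) u :=
    fun j => pderiv_comm (contDiffAt_coord (h.smooth u hu) j)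
  have hprod : ∀ a b : Fin 2, (connMatrix G X a u * connMatrix G X b u) l k
      = ∑ i, ∑ j, (∑ q, christoffel G l i q (X u) * christoffel G q j k (X u))
          * velocity X a u i * velocity X b u j := by
    intro a b
    simp only [Matrix.mul_apply, connMatrix, Matrix.of_apply, Finset.sum_mul, Finset.mul_sum]
    rw [Finset.sum_comm]
    refine Eq.trans ?_ Finset.sum_comm
    refine Finset.sum_congr rfl fun j _ => ?_
    rw [Finset.sum_comm]
    exact Finset.sum_congr rfl fun i _ => Finset.sum_congr rfl fun q _ => by ring
  have hswap : ∀ F : Fin n → Fin n → ℝ, (∑ i, ∑ j, F i j * velocity X b u i * velocity X a u j)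
      = ∑ i, ∑ j, F j i * velocity X a u i * velocity X b u j := by
    intro F
    rw [Finset.sum_comm]
    exact Finset.sum_congr rfl fun i _ => Finset.sum_congr rfl fun j _ => by ring
  rw [Matrix.sub_apply, Matrix.add_apply, Matrix.sub_apply, key a b, key b a, hprod a b,
    hprod b a, hswap, hswap]
  simp only [hc, riemann, add_mul, sub_mul, Finset.sum_add_distrib, Finset.sum_sub_distrib]
  ring

theorem curvatureForm_eq (a b : Fin 2) (Z W : Fin n → ℝ) :
    curvatureForm G (X u) (velocity X a u) (velocity X b u) Z W
      = W ⬝ᵥ G (X u) *ᵥ ((pderivMat a (connMatrix G X b) u - pderivMat b (connMatrix G X a) u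
          + connMatrix G X a u * connMatrix G X b u - connMatrix G X b u * connMatrix G X a u)
        *ᵥ Z) := by
  simp only [curvatureForm, dotProduct, mulVec]
  simp only [h.curvature_connMatrix hu, Finset.mul_sum, Finset.sum_mul]
  refine Finset.sum_congr rfl fun q _ => Finset.sum_congr rfl fun l _ =>
    Finset.sum_congr rfl fun k _ => Finset.sum_congr rfl fun i _ =>
    Finset.sum_congr rfl fun j _ => ?_
  rw [(h.symm (X u)).apply]; ring

/-- Compatibility moves the outer covariant derivative off the second-order terms. What remains
involves only first covariant derivatives of the velocities and derivatives of scalar pairings. -/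
theorem curvatureForm_velocity :
    curvatureForm G (X u) (velocity X 0 u) (velocity X 1 u) (velocity X 1 u) (velocity X 0 u)
      = pderiv 0 (fun v => covDeriv G X 1 (velocity X 1) v ⬝ᵥ G (X v) *ᵥ velocity X 0 v) u
        - pderiv 1 (fun v => covDeriv G X 0 (velocity X 1) v ⬝ᵥ G (X v) *ᵥ velocity X 0 v) u
        - covDeriv G X 1 (velocity X 1) u ⬝ᵥ G (X u) *ᵥ covDeriv G X 0 (velocity X 0) u
        + covDeriv G X 0 (velocity X 1) u ⬝ᵥ G (X u) *ᵥ covDeriv G X 1 (velocity X 0) u := by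
  have hv := h.contDiffAt_velocity hu
  rw [h.curvatureForm_eq hu, ← h.covDeriv_covDeriv hu (hv 1) 0 1, form_comm (h.symm _),
    h.pderiv_form hu (h.contDiffAt_covDeriv hu (hv 1) 1) (hv 0),
    h.pderiv_form hu (h.contDiffAt_covDeriv hu (hv 1) 0) (hv 0), sub_dotProduct]
  ring

/-- The Koszul formula. -/
theorem covDeriv_velocity_form (a b d : Fin 2) :
    covDeriv G X a (velocity X b) u ⬝ᵥ G (X u) *ᵥ velocity X d u
      = (1 / 2) * (pderiv a (fun v => gram G X v b d) u + pderiv b (fun v => gram G X v a d) u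
          - pderiv d (fun v => gram G X v a b) u) := by
  have hv := h.contDiffAt_velocity hu
  simp only [gram, Matrix.of_apply]
  rw [h.pderiv_form hu (hv b) (hv d), h.pderiv_form hu (hv a) (hv d),
    h.pderiv_form hu (hv a) (hv b), h.covDeriv_velocity_comm hu b a,
    h.covDeriv_velocity_comm hu d a, h.covDeriv_velocity_comm hu d b,
    form_comm (h.symm _) (velocity X b u), form_comm (h.symm _) (velocity X a u)]
  ring

end IsMetricAlong
end Along

/-! ### The Gauss equation in coordinates -/

/-- The Christoffel symbol of the first kind of the metric `g` on the parameter domain. -/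
def christoffelFirst (g : Euc 2 → Matrix (Fin 2) (Fin 2) ℝ) (a b d : Fin 2) (u : Euc 2) : ℝ :=
  (1 / 2) * (pderiv a (fun v => g v b d) u + pderiv b (fun v => g v a d) u
    - pderiv d (fun v => g v a b) u)

/-- The component `g(R(∂_0, ∂_1)∂_1, ∂_0)` of the curvature of `g`, in terms of the Christoffel
symbols of the first kind. -/
def curvatureFirst (g : Euc 2 → Matrix (Fin 2) (Fin 2) ℝ) (u : Euc 2) : ℝ :=
  pderiv 0 (christoffelFirst g 1 1 0) u - pderiv 1 (christoffelFirst g 0 1 0) u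
    - ∑ c, ∑ d, (g u)⁻¹ c d * (christoffelFirst g 1 1 c u * christoffelFirst g 0 0 d u
        - christoffelFirst g 0 1 c u * christoffelFirst g 1 0 d u)

/-! ### Linear algebra: adapted frames and traces of bivectors -/

section Linear

/-- The Gram matrix of the frame (e, N) is block diagonal with blocks `g` and 1, and a form is
recovered from pairings with a basis by the inverse Gram matrix. -/
theorem form_eq_of_frame {n p : ℕ} (hn : n = 2 + p) {A : Matrix (Fin n) (Fin n) ℝ}
    (hA : A.IsSymm) {e : Fin 2 → Fin n → ℝ} {N : Fin p → Fin n → ℝ}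
    {g : Matrix (Fin 2) (Fin 2) ℝ} (hg : g.det ≠ 0) (he : ∀ a b, g a b = e a ⬝ᵥ A *ᵥ e b)
    (hN : ∀ i j, N i ⬝ᵥ A *ᵥ N j = if i = j then 1 else 0) (hNe : ∀ i a, N i ⬝ᵥ A *ᵥ e a = 0)
    (v w : Fin n → ℝ) :
    v ⬝ᵥ A *ᵥ w = ∑ c, ∑ d, g⁻¹ c d * ((v ⬝ᵥ A *ᵥ e c) * (w ⬝ᵥ A *ᵥ e d))
      + ∑ i, (v ⬝ᵥ A *ᵥ N i) * (w ⬝ᵥ A *ᵥ N i) := by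
  set b : Fin 2 ⊕ Fin p → Fin n → ℝ := Sum.elim e N with hb
  set B : Matrix (Fin n) (Fin 2 ⊕ Fin p) ℝ := Matrix.of fun i μ => b μ i with hB
  have hcol : ∀ x : Fin n → ℝ, Bᵀ *ᵥ A *ᵥ x = fun μ => x ⬝ᵥ A *ᵥ b μ := by
    intro x
    ext μ
    rw [form_comm hA x]
    rfl
  have hgram : Bᵀ * A * B = fromBlocks g 0 0 1 := by
    have h1 : ∀ μ ν, (Bᵀ * A * B) μ ν = b μ ⬝ᵥ A *ᵥ b ν := by
      intro μ ν
      have : (Bᵀ * A * B) μ ν = (Bᵀ *ᵥ A *ᵥ b ν) μ := by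
        rw [mulVec_mulVec]; rfl
      rw [this, hcol, form_comm hA]
    ext μ ν
    rw [h1]
    rcases μ with a | i <;> rcases ν with c | j
    · simp [hb, he]
    · simp [hb, form_comm hA (e a), hNe]
    · simp [hb, hNe]
    · simp [hb, hN, Matrix.one_apply]
  set Q : Matrix (Fin 2 ⊕ Fin p) (Fin 2 ⊕ Fin p) ℝ := fromBlocks g⁻¹ 0 0 1 with hQ
  have hinv : (Q * Bᵀ * A) * B = 1 := by
    rw [Matrix.mul_assoc, Matrix.mul_assoc, ← Matrix.mul_assoc Bᵀ, hgram, hQ, fromBlocks_multiply]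
    simp [Matrix.nonsing_inv_mul _ (isUnit_iff_ne_zero.mpr hg)]
  -- The frame has `2 + p = n` members, so `B` is square up to reindexing and its left inverse is
  -- also a right inverse; this is where the frame is seen to span.
  have hinv' : B * (Q * Bᵀ * A) = 1 :=
    (Matrix.mul_eq_one_comm_of_card_eq _ _ _ (by simp [hn])).1 hinv
  have hw : w = B *ᵥ (Q *ᵥ (Bᵀ *ᵥ A *ᵥ w)) := by
    simp only [mulVec_mulVec]
    simp only [← Matrix.mul_assoc] at hinv' ⊢
    rw [hinv', one_mulVec]
  have h2 : v ⬝ᵥ A *ᵥ w = (Bᵀ *ᵥ A *ᵥ v) ⬝ᵥ (Q *ᵥ (Bᵀ *ᵥ A *ᵥ w)) := by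
    conv_lhs => rw [form_comm hA, hw]
    rw [dotProduct_comm, dotProduct_mulVec, ← mulVec_transpose]
  rw [h2, hcol, hcol]
  simp only [hQ, dotProduct, mulVec, Fintype.sum_sum_type, fromBlocks_apply₁₁, fromBlocks_apply₁₂,
    fromBlocks_apply₂₁, fromBlocks_apply₂₂, hb, Sum.elim_inl, Sum.elim_inr, Matrix.zero_apply,
    zero_mul, Finset.sum_const_zero, add_zero, zero_add, Matrix.one_apply, ite_mul, one_mul,
    Finset.sum_ite_eq, Finset.mem_univ, if_true]
  congr 1
  refine Finset.sum_congr rfl fun c _ => ?_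
  rw [Finset.mul_sum]
  refine Finset.sum_congr rfl fun d _ => ?_
  ring

/-- A product of two rank-one maps has rank at most one, so its trace is a product of two pairings.
-/
theorem trace_vecMulVec_mul {n : ℕ} (A : Matrix (Fin n) (Fin n) ℝ) (a b c d : Fin n → ℝ) :
    (vecMulVec a b * A * (vecMulVec c d * A)).trace = (b ⬝ᵥ A *ᵥ c) * (d ⬝ᵥ A *ᵥ a) := by
  rw [vecMulVec_mul a b A, vecMulVec_mul c d A, vecMulVec_mul_vecMulVec, vecMulVec_smul, trace_smul, trace_vecMulVec,
    dotProduct_mulVec, dotProduct_mulVec, dotProduct_comm a, smul_eq_mul]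

/-- The bivector `r (x₀ ⊗ y₁ - x₁ ⊗ y₀)`. -/
def bivector {n : ℕ} (r : ℝ) (x y : Fin 2 → Fin n → ℝ) : Matrix (Fin n) (Fin n) ℝ :=
  r • (vecMulVec (x 0) (y 1) - vecMulVec (x 1) (y 0))

theorem trace_bivector_mul_bivector {n : ℕ} (A : Matrix (Fin n) (Fin n) ℝ) (r : ℝ)
    (x y z w : Fin 2 → Fin n → ℝ) :
    (bivector r x y * A * (bivector r z w * A)).trace
      = r ^ 2 * ((y 1 ⬝ᵥ A *ᵥ z 0) * (w 1 ⬝ᵥ A *ᵥ x 0) - (y 1 ⬝ᵥ A *ᵥ z 1) * (w 0 ⬝ᵥ A *ᵥ x 0)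
        - (y 0 ⬝ᵥ A *ᵥ z 0) * (w 1 ⬝ᵥ A *ᵥ x 1)
        + (y 0 ⬝ᵥ A *ᵥ z 1) * (w 0 ⬝ᵥ A *ᵥ x 1)) := by
  simp only [bivector, Matrix.smul_mul, Matrix.mul_smul, Matrix.sub_mul, Matrix.mul_sub,
    trace_smul, trace_sub, trace_vecMulVec_mul, smul_eq_mul]
  ring

theorem trace_inv_mul_fin_two (g h : Matrix (Fin 2) (Fin 2) ℝ) :
    (g⁻¹ * h).trace
      = (g 1 1 * h 0 0 + g 0 0 * h 1 1 - g 0 1 * h 1 0 - g 1 0 * h 0 1) / g.det := by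
  rw [Matrix.inv_def, Matrix.smul_mul, trace_smul, adjugate_fin_two, trace_fin_two,
    Ring.inverse_eq_inv']
  simp [Matrix.mul_apply]
  ring

end Linear

/-! ### The Gauss and Weingarten equations, extrinsic and intrinsic -/

section Gauss
variable {n p : ℕ} {G : Euc n → Matrix (Fin n) (Fin n) ℝ} {X : Euc 2 → Euc n} {V : Set (Euc 2)}
  {u : Euc 2} {g : Euc 2 → Matrix (Fin 2) (Fin 2) ℝ}

namespace IsMetricAlong

/-- The Koszul formula holds on all of the open set `V`, not just at `u`, and can therefore be
differentiated. -/
theorem pderiv_covDeriv_form (h : IsMetricAlong G X V) (hg : ∀ v ∈ V, g v = gram G X v)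
    (hu : u ∈ V) (a b c d : Fin 2) :
    pderiv c (fun v => covDeriv G X a (velocity X b) v ⬝ᵥ G (X v) *ᵥ velocity X d v) u
      = pderiv c (christoffelFirst g a b d) u := by
  have hgv : ∀ v ∈ V, ∀ a b, (fun v => g v a b) =ᶠ[𝓝 v] fun v => gram G X v a b := by
    intro v hv a b
    filter_upwards [h.isOpen.mem_nhds hv] with z hz
    rw [hg z hz]
  refine pderiv_congr ?_
  filter_upwards [h.isOpen.mem_nhds hu] with v hv
  rw [h.covDeriv_velocity_form hv, christoffelFirst, pderiv_congr (hgv v hv b d),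
    pderiv_congr (hgv v hv a d), pderiv_congr (hgv v hv a b)]

theorem covDeriv_velocity_form_eq (h : IsMetricAlong G X V) (hg : ∀ v ∈ V, g v = gram G X v)
    (hu : u ∈ V) (a b d : Fin 2) :
    covDeriv G X a (velocity X b) u ⬝ᵥ G (X u) *ᵥ velocity X d u = christoffelFirst g a b d u := by
  have hgv : ∀ a b, (fun v => g v a b) =ᶠ[𝓝 u] fun v => gram G X v a b := by
    intro a b
    filter_upwards [h.isOpen.mem_nhds hu] with z hz
    rw [hg z hz]
  rw [h.covDeriv_velocity_form hu, christoffelFirst, pderiv_congr (hgv b d),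
    pderiv_congr (hgv a d), pderiv_congr (hgv a b)]

/-- The Gauss equation, for an orthonormal normal frame at a point. -/
theorem gauss_equation (h : IsMetricAlong G X V) (hg : ∀ v ∈ V, g v = gram G X v)
    (hu : u ∈ V) (hn : n = 2 + p) (hdet : (g u).det ≠ 0)
    {N : Fin p → Fin n → ℝ} (hN : ∀ i j, N i ⬝ᵥ G (X u) *ᵥ N j = if i = j then 1 else 0)
    (hNe : ∀ i a, N i ⬝ᵥ G (X u) *ᵥ velocity X a u = 0) :
    curvatureForm G (X u) (velocity X 0 u) (velocity X 1 u) (velocity X 1 u) (velocity X 0 u)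
      = curvatureFirst g u
        - ∑ A, ((covDeriv G X 1 (velocity X 1) u ⬝ᵥ G (X u) *ᵥ N A)
              * (covDeriv G X 0 (velocity X 0) u ⬝ᵥ G (X u) *ᵥ N A)
            - (covDeriv G X 0 (velocity X 1) u ⬝ᵥ G (X u) *ᵥ N A)
              * (covDeriv G X 1 (velocity X 0) u ⬝ᵥ G (X u) *ᵥ N A)) := by
  have hp := fun v w => form_eq_of_frame hn (h.symm (X u)) hdet
    (e := fun a => velocity X a u) (N := N) (fun a b => by rw [hg u hu]; rfl) hN hNe v w
  -- Only the two products of covariant derivatives are split along the frame; their tangential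
  -- parts are the quadratic terms of `curvatureFirst`.
  rw [h.curvatureForm_velocity hu, h.pderiv_covDeriv_form hg hu, h.pderiv_covDeriv_form hg hu,
    hp (covDeriv G X 1 (velocity X 1) u), hp (covDeriv G X 0 (velocity X 1) u)]
  simp only [h.covDeriv_velocity_form_eq hg hu, curvatureFirst, mul_sub, Finset.sum_sub_distrib]
  ring

/-- The Weingarten equation. -/
theorem weingarten_equation (h : IsMetricAlong G X V) (hu : u ∈ V) {Z : Euc 2 → Fin n → ℝ}
    (hZ : ∀ i, ContDiffAt ℝ ∞ (fun v => Z v i) u)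
    (hZe : ∀ v ∈ V, ∀ a, Z v ⬝ᵥ G (X v) *ᵥ velocity X a v = 0) (a b : Fin 2) :
    covDeriv G X a Z u ⬝ᵥ G (X u) *ᵥ velocity X b u
      = -(covDeriv G X a (velocity X b) u ⬝ᵥ G (X u) *ᵥ Z u) := by
  have h1 := h.pderiv_form hu hZ (h.contDiffAt_velocity hu b) a
  -- The pairing of `Z` with the velocity vanishes near `u`, so its derivative does too, and
  -- compatibility gives the relation.
  have h2 : (fun v => Z v ⬝ᵥ G (X v) *ᵥ velocity X b v) =ᶠ[𝓝 u] fun _ => 0 := by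
    filter_upwards [h.isOpen.mem_nhds hu] with v hv using hZe v hv b
  rw [pderiv_congr h2, pderiv_const, form_comm (h.symm _) (Z u)] at h1
  linarith

end IsMetricAlong

theorem velocity_id (a : Fin 2) (u : Euc 2) : velocity id a u = Pi.single a 1 := by
  ext i
  have : fderiv ℝ (fun v : Euc 2 => v i) u = EuclideanSpace.proj i :=
    (EuclideanSpace.proj (𝕜 := ℝ) i).fderiv
  simp [velocity, pderivVec, pderiv, this, Pi.single_apply]

theorem gram_id (g : Euc 2 → Matrix (Fin 2) (Fin 2) ℝ) (u : Euc 2) : gram g id u = g u := by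
  ext a b
  simp [gram, velocity_id]

/-- The plane with metric `g`, parametrised by the identity, is a surface of codimension zero in
itself: the sum over normals is empty, and the Gauss equation identifies `curvatureFirst` with the
curvature of `g`. -/
theorem curvatureForm_eq_curvatureFirst (hV : IsOpen V) (hs : ∀ u, (g u).IsSymm)
    (hg : ∀ u ∈ V, ∀ a b, ContDiffAt ℝ ∞ (fun v => g v a b) u) (hdet : ∀ u ∈ V, (g u).det ≠ 0)
    (hu : u ∈ V) :
    curvatureForm g u (Pi.single 0 1) (Pi.single 1 1) (Pi.single 1 1) (Pi.single 0 1)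
      = curvatureFirst g u := by
  have h : IsMetricAlong g id V := ⟨hV, hs, fun _ _ => contDiffAt_id, hg, hdet⟩
  have := h.gauss_equation (p := 0) (fun v _ => (gram_id g v).symm) hu rfl (hdet u hu)
    (N := Fin.elim0) (fun i => i.elim0) (fun i => i.elim0)
  simpa [velocity_id] using this

end Gauss

/-! ### The ambient metric in a chart -/

section Charts

variable {m p : ℕ}
  {M : Type*} [TopologicalSpace M] [ChartedSpace (Euc m) M]
  {ψ : OpenPartialHomeomorph M (Euc m)}

theorem mdifferentiable_of_mem_maximalAtlas
    (hψ : ψ ∈ IsManifold.maximalAtlas (𝓡 m) ∞ M) : ψ.MDifferentiable (𝓡 m) (𝓡 m) :=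
  ⟨(contMDiffOn_of_mem_maximalAtlas hψ).mdifferentiableOn (by simp),
    (contMDiffOn_symm_of_mem_maximalAtlas hψ).mdifferentiableOn (by simp)⟩

/-- The components, in the chart `ψ`, of a tangent vector. -/
def chartComp (ψ : OpenPartialHomeomorph M (Euc m)) (q : M) (v : TangentSpace (𝓡 m) q) :
    Fin m → ℝ :=
  WithLp.ofLp (p := 2) (V := Fin m → ℝ) (mfderiv (𝓡 m) (𝓡 m) ψ q v)

theorem mfderiv_symm_mfderiv [IsManifold (𝓡 m) ∞ M] (hψ : ψ ∈ IsManifold.maximalAtlas (𝓡 m) ∞ M)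
    {y : Euc m} (hy : y ∈ ψ.target) (v : TangentSpace (𝓡 m) (ψ.symm y)) :
    v = mfderiv (𝓡 m) (𝓡 m) ψ.symm y
      (mfderiv (𝓡 m) (𝓡 m) ψ (ψ.symm y) v : Euc m) := by
  have h1 := (mdifferentiable_of_mem_maximalAtlas hψ).symm_comp_deriv (ψ.map_target hy)
  -- The base point occurs in the type of the derivative, so the equality of base points is used by
  -- substitution, with values read in the model space.
  have h2 : ∀ z : Euc m, z = y → ∀ w : Euc m,
      (mfderiv (𝓡 m) (𝓡 m) ψ.symm z w : Euc m) = (mfderiv (𝓡 m) (𝓡 m) ψ.symm y w : Euc m) := by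
    rintro z rfl w; rfl
  have h3 := DFunLike.congr_fun h1 v
  exact h3.symm.trans (h2 _ (ψ.right_inv hy) _)

theorem chartComp_eq_zero_iff [IsManifold (𝓡 m) ∞ M]
    (hψ : ψ ∈ IsManifold.maximalAtlas (𝓡 m) ∞ M) {q : M} (hq : q ∈ ψ.source)
    (v : TangentSpace (𝓡 m) q) : chartComp ψ q v = 0 ↔ v = 0 := by
  have hinj := ((mdifferentiable_of_mem_maximalAtlas hψ).mfderiv_bijective hq).injective
  constructor
  · intro h
    apply hinj
    rw [map_zero]
    exact (WithLp.ofLp_eq_zero 2).1 h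
  · rintro rfl
    simp only [chartComp, map_zero]
    rfl

section Metric
variable {r : ℕ∞ω} [IsManifold (𝓡 m) ∞ M] (gbar : Bundle.ContMDiffRiemannianMetric (𝓡 m) r (Euc m)
      (fun x : M => TangentSpace (𝓡 m) x))

theorem ambientMetric_isSymm (ψ : OpenPartialHomeomorph M (Euc m)) (y : Euc m) :
    (ambientMetric gbar ψ y).IsSymm := by
  ext i j
  exact gbar.symm _ _ _

theorem inner_eq_form (hψ : ψ ∈ IsManifold.maximalAtlas (𝓡 m) ∞ M) {q : M} (hq : q ∈ ψ.source)
    (v w : TangentSpace (𝓡 m) q) :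
    gbar.inner q v w
      = chartComp ψ q v ⬝ᵥ ambientMetric gbar ψ (ψ q) *ᵥ chartComp ψ q w := by
  obtain ⟨y, hy, rfl⟩ : ∃ y ∈ ψ.target, ψ.symm y = q :=
    ⟨ψ q, ψ.map_source hq, ψ.left_inv hq⟩
  have hexp : ∀ v : TangentSpace (𝓡 m) (ψ.symm y),
      v = ∑ i, chartComp ψ _ v i • mfderiv (𝓡 m) (𝓡 m) ψ.symm y
        (EuclideanSpace.single i 1 : Euc m) := by
    intro v
    have h1 := mfderiv_symm_mfderiv hψ hy v
    have h2 := sum_smul_single (mfderiv (𝓡 m) (𝓡 m) ψ (ψ.symm y) v : Euc m)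
    have h3 : (mfderiv (𝓡 m) (𝓡 m) ψ.symm y
        (mfderiv (𝓡 m) (𝓡 m) ψ (ψ.symm y) v : Euc m))
        = ∑ i, chartComp ψ _ v i • mfderiv (𝓡 m) (𝓡 m) ψ.symm y
        (EuclideanSpace.single i 1 : Euc m) := by
      refine (congrArg (mfderiv (𝓡 m) (𝓡 m) ψ.symm y) h2).trans ?_
      refine (map_sum (mfderiv (𝓡 m) (𝓡 m) ψ.symm y) _ _).trans ?_
      exact Finset.sum_congr rfl fun i _ => map_smul (mfderiv (𝓡 m) (𝓡 m) ψ.symm y) _ _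
    exact h1.trans h3
  conv_lhs => rw [hexp v, hexp w]
  rw [ψ.right_inv hy]
  simp only [map_sum, map_smul, _root_.sum_apply, _root_.smul_apply,
    smul_eq_mul, dotProduct, mulVec, ambientMetric, Matrix.of_apply, Finset.mul_sum]
  rw [Finset.sum_comm]
  exact Finset.sum_congr rfl fun i _ => Finset.sum_congr rfl fun j _ => by ring

/-- A kernel vector would be the component vector of a nonzero tangent vector of length zero. -/
theorem ambientMetric_det_ne_zero (hψ : ψ ∈ IsManifold.maximalAtlas (𝓡 m) ∞ M) {y : Euc m}
    (hy : y ∈ ψ.target) : (ambientMetric gbar ψ y).det ≠ 0 := by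
  intro h0
  obtain ⟨c, hc, hGc⟩ := Matrix.exists_mulVec_eq_zero_iff.2 h0
  have hbij := (mdifferentiable_of_mem_maximalAtlas hψ).mfderiv_bijective (ψ.map_target hy)
  obtain ⟨v, hv⟩ := hbij.surjective (WithLp.toLp 2 c : Euc m)
  have hvc : chartComp ψ _ v = c := congrArg (WithLp.ofLp (p := 2) (V := Fin m → ℝ)) hv
  have hv0 : v ≠ 0 := by
    intro hv0
    exact hc (hvc.symm.trans ((chartComp_eq_zero_iff hψ (ψ.map_target hy) v).2 hv0))
  have hpos := gbar.pos _ v hv0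
  rw [inner_eq_form gbar hψ (ψ.map_target hy), hvc, ψ.right_inv hy, hGc] at hpos
  simp at hpos

/-- The coordinate fields are the tangent map of `ψ.symm` applied to constant sections, hence smooth
sections; the metric is a smooth section of bilinear forms evaluated on them. -/
theorem contDiffAt_ambientMetric (hr : ∞ ≤ r) (hψ : ψ ∈ IsManifold.maximalAtlas (𝓡 m) ∞ M)
    {y : Euc m} (hy : y ∈ ψ.target) (i j : Fin m) :
    ContDiffAt ℝ ∞ (fun z => ambientMetric gbar ψ z i j) y := by
  have hs : ContMDiffOn (𝓡 m) (𝓡 m) ∞ ψ.symm ψ.target := contMDiffOn_symm_of_mem_maximalAtlas hψ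
  have hI : IsManifold (𝓡 m) 1 M := IsManifold.of_le (n := ∞) (by simp)
  have hT := hs.contMDiffOn_tangentMapWithin (m := ∞) (by simp) ψ.open_target.uniqueMDiffOn
  have hcoord : ∀ i, ContMDiffAt (𝓡 m) ((𝓡 m).prod (𝓡 m)) ∞
      (fun z => (⟨ψ.symm z, mfderiv (𝓡 m) (𝓡 m) ψ.symm z (EuclideanSpace.single i 1 : Euc m)⟩ :
        Bundle.TotalSpace (Euc m) (fun x : M => TangentSpace (𝓡 m) x))) y := by
    intro i
    have hconst : ContMDiffAt (𝓡 m) ((𝓡 m).prod (𝓡 m)) ∞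
        (fun z => (⟨z, (EuclideanSpace.single i 1 : Euc m)⟩ :
          Bundle.TotalSpace (Euc m) (fun x : Euc m => TangentSpace (𝓡 m) x))) y :=
      contMDiffAt_vectorSpace_iff_contDiffAt.2 contDiffAt_const
    have hT' : ContMDiffAt ((𝓡 m).prod (𝓡 m)) ((𝓡 m).prod (𝓡 m)) ∞
        (tangentMapWithin (𝓡 m) (𝓡 m) ψ.symm ψ.target)
        (⟨y, (EuclideanSpace.single i 1 : Euc m)⟩ :
          Bundle.TotalSpace (Euc m) (fun x : Euc m => TangentSpace (𝓡 m) x)) := by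
      refine hT.contMDiffAt ((ψ.open_target.preimage ?_).mem_nhds hy)
      exact FiberBundle.continuous_proj _ _
    -- Smoothness is known for the derivative within the target, which is open, so it agrees there
    -- with the full derivative.
    refine (hT'.comp y hconst).congr_of_eventuallyEq ?_
    filter_upwards [ψ.open_target.mem_nhds hy] with z hz
    simp only [Function.comp_apply, tangentMapWithin, mfderivWithin_of_isOpen ψ.open_target hz]
  have hg := (gbar.contMDiff.of_le hr).contMDiffAt.comp y
    (contMDiffAt_symm_of_mem_maximalAtlas hψ hy)
  have := ContMDiffAt.clm_bundle_apply₂ (F₁ := Euc m) (F₂ := Euc m) (F₃ := ℝ)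
    (E₃ := Bundle.Trivial M ℝ) hg (hcoord i) (hcoord j)
  rw [Bundle.contMDiffAt_totalSpace] at this
  exact this.2.contDiffAt

end Metric
end Charts

/-! ### The immersed surface and its tensors in charts -/

section Surface

set_option linter.unusedSectionVars false

variable {m p : ℕ} {r : ℕ∞ω}
  {S : Type*} [TopologicalSpace S] [ChartedSpace (Euc 2) S]
  {M : Type*} [TopologicalSpace M] [ChartedSpace (Euc m) M]
  {φ : OpenPartialHomeomorph S (Euc 2)} {ψ : OpenPartialHomeomorph M (Euc m)} {f : S → M}
  {U : Set S} {u : Euc 2}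

/-- The surface in the coordinates given by `φ` and `ψ`. -/
def localMap (f : S → M) (φ : OpenPartialHomeomorph S (Euc 2))
    (ψ : OpenPartialHomeomorph M (Euc m)) (u : Euc 2) : Euc m :=
  ψ (f (φ.symm u))

/-- The points of the coordinate domain that correspond to points of `U` mapped into the domain
of `ψ`. -/
def localDomain (f : S → M) (φ : OpenPartialHomeomorph S (Euc 2))
    (ψ : OpenPartialHomeomorph M (Euc m)) (U : Set S) : Set (Euc 2) :=
  φ.target ∩ φ.symm ⁻¹' (U ∩ f ⁻¹' ψ.source)

theorem isOpen_localDomain (φ : OpenPartialHomeomorph S (Euc 2))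
    (ψ : OpenPartialHomeomorph M (Euc m)) (hf : ContMDiff (𝓡 2) (𝓡 m) ∞ f) (hU : IsOpen U) :
    IsOpen (localDomain f φ ψ U) :=
  φ.isOpen_inter_preimage_symm (hU.inter (ψ.open_source.preimage hf.continuous))

theorem contMDiffAt_comp_symm (hφ : φ ∈ IsManifold.maximalAtlas (𝓡 2) ∞ S)
    (hf : ContMDiff (𝓡 2) (𝓡 m) ∞ f) (hu : u ∈ φ.target) :
    ContMDiffAt (𝓡 2) (𝓡 m) ∞ (fun v => f (φ.symm v)) u :=
  hf.contMDiffAt.comp u (contMDiffAt_symm_of_mem_maximalAtlas hφ hu)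

theorem contDiffAt_localMap (hφ : φ ∈ IsManifold.maximalAtlas (𝓡 2) ∞ S)
    (hψ : ψ ∈ IsManifold.maximalAtlas (𝓡 m) ∞ M)
    (hf : ContMDiff (𝓡 2) (𝓡 m) ∞ f) (hu : u ∈ localDomain f φ ψ U) :
    ContDiffAt ℝ ∞ (localMap f φ ψ) u :=
  ((contMDiffAt_of_mem_maximalAtlas hψ hu.2.2).comp u
    (contMDiffAt_comp_symm hφ hf hu.1)).contDiffAt

theorem chartComp_tangentBasis (hφ : φ ∈ IsManifold.maximalAtlas (𝓡 2) ∞ S)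
    (hψ : ψ ∈ IsManifold.maximalAtlas (𝓡 m) ∞ M)
    (hf : ContMDiff (𝓡 2) (𝓡 m) ∞ f) (hu : u ∈ localDomain f φ ψ U) (a : Fin 2) :
    chartComp ψ (f (φ.symm u)) (tangentBasis f φ a u) = velocity (localMap f φ ψ) a u := by
  have hX := contDiffAt_localMap hφ hψ hf hu
  have h1 := mfderiv_comp u
    ((contMDiffAt_of_mem_maximalAtlas hψ hu.2.2).mdifferentiableAt (by simp))
    ((contMDiffAt_comp_symm hφ hf hu.1).mdifferentiableAt (by simp))
  have h2 : mfderiv (𝓡 2) (𝓡 m) (localMap f φ ψ) u = fderiv ℝ (localMap f φ ψ) u :=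
    mfderiv_eq_fderiv
  ext i
  have h3 : velocity (localMap f φ ψ) a u i
      = fderiv ℝ (localMap f φ ψ) u (EuclideanSpace.single a 1) i := by
    have h4 : fderiv ℝ (fun z => localMap f φ ψ z i) u = _ :=
      ((EuclideanSpace.proj (𝕜 := ℝ) i).hasFDerivAt.comp u
        (differentiableAt_of_smooth hX).hasFDerivAt).fderiv
    simp only [velocity, pderivVec, pderiv]
    rw [h4]
    rfl
  rw [h3, ← h2]
  exact congrArg (fun w : Euc m => w i)
    (DFunLike.congr_fun h1 (EuclideanSpace.single a 1 : Euc 2)).symm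

variable [IsManifold (𝓡 m) ∞ M] (gbar : Bundle.ContMDiffRiemannianMetric (𝓡 m) r (Euc m)
      (fun x : M => TangentSpace (𝓡 m) x))

theorem isMetricAlong_localMap (hr : ∞ ≤ r) (hφ : φ ∈ IsManifold.maximalAtlas (𝓡 2) ∞ S)
    (hψ : ψ ∈ IsManifold.maximalAtlas (𝓡 m) ∞ M)
    (hf : ContMDiff (𝓡 2) (𝓡 m) ∞ f) (hU : IsOpen U) :
    IsMetricAlong (ambientMetric gbar ψ) (localMap f φ ψ) (localDomain f φ ψ U) where
  isOpen := isOpen_localDomain φ ψ hf hU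
  symm := ambientMetric_isSymm gbar ψ
  smooth _ hu := contDiffAt_localMap hφ hψ hf hu
  smooth_metric _ hu := contDiffAt_ambientMetric gbar hr hψ (ψ.map_source hu.2.2)
  det_ne_zero _ hu := ambientMetric_det_ne_zero gbar hψ (ψ.map_source hu.2.2)

theorem inducedMetric_eq_gram (hφ : φ ∈ IsManifold.maximalAtlas (𝓡 2) ∞ S)
    (hψ : ψ ∈ IsManifold.maximalAtlas (𝓡 m) ∞ M)
    (hf : ContMDiff (𝓡 2) (𝓡 m) ∞ f) (hu : u ∈ localDomain f φ ψ U) :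
    inducedMetric gbar f φ u = gram (ambientMetric gbar ψ) (localMap f φ ψ) u := by
  ext a b
  simp only [inducedMetric, gram, Matrix.of_apply]
  rw [inner_eq_form gbar hψ hu.2.2, chartComp_tangentBasis hφ hψ hf hu,
    chartComp_tangentBasis hφ hψ hf hu]
  rfl

theorem inducedMetric_isSymm (f : S → M) (φ : OpenPartialHomeomorph S (Euc 2)) (u : Euc 2) :
    (inducedMetric gbar f φ u).IsSymm := by
  ext i j
  exact gbar.symm _ _ _

/-- Normality of the frame is a condition on the image of the differential of `f`, so the coordinate
vectors have to be exhibited in that image. -/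
theorem tangentBasis_eq (hφ : φ ∈ IsManifold.maximalAtlas (𝓡 2) ∞ S)
    (hf : ContMDiff (𝓡 2) (𝓡 m) ∞ f) (hu : u ∈ φ.target) (a : Fin 2) :
    tangentBasis f φ a u = mfderiv (𝓡 2) (𝓡 m) f (φ.symm u)
      (mfderiv (𝓡 2) (𝓡 2) φ.symm u (EuclideanSpace.single a 1 : Euc 2)) := by
  have h1 := mfderiv_comp u (hf.contMDiffAt.mdifferentiableAt (x := φ.symm u) (by simp))
    ((contMDiffAt_symm_of_mem_maximalAtlas hφ hu).mdifferentiableAt (by simp))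
  exact DFunLike.congr_fun h1 (EuclideanSpace.single a 1 : Euc 2)

/-- Since `f` is an immersion, a kernel vector would give a nonzero tangent vector of `M` of length
zero. -/
theorem inducedMetric_det_ne_zero (hφ : φ ∈ IsManifold.maximalAtlas (𝓡 2) ∞ S)
    (hf : ContMDiff (𝓡 2) (𝓡 m) ∞ f)
    (himm : ∀ s, Function.Injective (mfderiv (𝓡 2) (𝓡 m) f s)) (hu : u ∈ φ.target) :
    (inducedMetric gbar f φ u).det ≠ 0 := by
  intro h0
  obtain ⟨c, hc, hGc⟩ := Matrix.exists_mulVec_eq_zero_iff.2 h0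
  set v : Euc 2 := WithLp.toLp 2 c with hv
  have hbij := (mdifferentiable_of_mem_maximalAtlas hφ).symm.mfderiv_bijective hu
  set D : Euc 2 →L[ℝ] TangentSpace (𝓡 m) (f (φ.symm u)) :=
    mfderiv (𝓡 2) (𝓡 m) (fun v => f (φ.symm v)) u with hD
  have hw : D v = ∑ a, c a • tangentBasis f φ a u := by
    conv_lhs => rw [sum_smul_single v]
    rw [map_sum]
    exact Finset.sum_congr rfl fun a _ => map_smul D _ _
  have hw0 : D v ≠ 0 := by
    intro hz
    have h1 := mfderiv_comp u (hf.contMDiffAt.mdifferentiableAt (x := φ.symm u) (by simp))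
      ((contMDiffAt_symm_of_mem_maximalAtlas hφ hu).mdifferentiableAt (by simp))
    have h2 : mfderiv (𝓡 2) (𝓡 m) f (φ.symm u) (mfderiv (𝓡 2) (𝓡 2) φ.symm u v) = 0 :=
      (DFunLike.congr_fun h1 v).symm.trans hz
    have h3 := himm _ (h2.trans (map_zero _).symm)
    have h4 : v = 0 := hbij.injective (h3.trans (map_zero _).symm)
    exact hc (congrArg WithLp.ofLp h4)
  have hpos := gbar.pos _ _ hw0
  have hzero : gbar.inner (f (φ.symm u)) (D v) (D v) = c ⬝ᵥ inducedMetric gbar f φ u *ᵥ c := by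
    rw [hw]
    simp only [map_sum, map_smul, _root_.sum_apply, _root_.smul_apply,
      smul_eq_mul, dotProduct, mulVec, inducedMetric, Matrix.of_apply, Finset.mul_sum]
    rw [Finset.sum_comm]
    exact Finset.sum_congr rfl fun i _ => Finset.sum_congr rfl fun j _ => by ring
  rw [hzero, hGc] at hpos
  simp at hpos

variable {N : Fin p → ∀ s : S, TangentSpace (𝓡 m) (f s)}

/-- The components of the normal vector `N A` in the coordinates given by `φ` and `ψ`. -/
def localNormal (ψ : OpenPartialHomeomorph M (Euc m)) (φ : OpenPartialHomeomorph S (Euc 2))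
    (N : Fin p → ∀ s : S, TangentSpace (𝓡 m) (f s)) (A : Fin p) (u : Euc 2) : Fin m → ℝ :=
  chartComp ψ (f (φ.symm u)) (N A (φ.symm u))

/-- The components are the fibre part of the tangent map of `ψ` composed with the smooth section `N
A`. -/
theorem contDiffAt_localNormal (hφ : φ ∈ IsManifold.maximalAtlas (𝓡 2) ∞ S)
    (hψ : ψ ∈ IsManifold.maximalAtlas (𝓡 m) ∞ M) (hf : ContMDiff (𝓡 2) (𝓡 m) ∞ f) (hU : IsOpen U)
    (hN : IsNormalFrame gbar f U N) (hu : u ∈ localDomain f φ ψ U) (A : Fin p) (i : Fin m) :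
    ContDiffAt ℝ ∞ (fun v => localNormal ψ φ N A v i) u := by
  have hI : IsManifold (𝓡 m) 1 M := IsManifold.of_le (n := ∞) (by simp)
  have hs : ContMDiffOn (𝓡 m) (𝓡 m) ∞ ψ ψ.source := contMDiffOn_of_mem_maximalAtlas hψ
  have hT := hs.contMDiffOn_tangentMapWithin (m := ∞) (by simp) ψ.open_source.uniqueMDiffOn
  have hT' : ContMDiffAt ((𝓡 m).prod (𝓡 m)) ((𝓡 m).prod (𝓡 m)) ∞
      (tangentMapWithin (𝓡 m) (𝓡 m) ψ ψ.source)
      (⟨f (φ.symm u), N A (φ.symm u)⟩ :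
        Bundle.TotalSpace (Euc m) (fun x : M => TangentSpace (𝓡 m) x)) := by
    refine hT.contMDiffAt ((ψ.open_source.preimage ?_).mem_nhds hu.2.2)
    exact FiberBundle.continuous_proj _ _
  have hNu := ((hN.smooth A).contMDiffAt (hU.mem_nhds hu.2.1)).comp u
    (contMDiffAt_symm_of_mem_maximalAtlas hφ hu.1)
  have h1 := (contMDiff_snd_tangentBundle_modelSpace (n := ∞) (Euc m) (𝓡 m)).contMDiffAt.comp u
    (hT'.comp u hNu)
  have h2 := (EuclideanSpace.proj (𝕜 := ℝ) i).contDiff.contDiffAt.comp u h1.contDiffAt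
  refine h2.congr_of_eventuallyEq ?_
  filter_upwards [(isOpen_localDomain φ ψ hf hU).mem_nhds hu] with v hv
  have hd : mfderivWithin (𝓡 m) (𝓡 m) ψ ψ.source (f (φ.symm v))
      = mfderiv (𝓡 m) (𝓡 m) ψ (f (φ.symm v)) := mfderivWithin_of_isOpen ψ.open_source hv.2.2
  exact (congrArg (fun w : Euc m => w i) (DFunLike.congr_fun hd (N A (φ.symm v)))).symm

theorem surfDeriv_surfDeriv (F : S → ℝ) (a b : Fin 2) {s : S} (hs : s ∈ φ.source) :
    surfDeriv φ a (surfDeriv φ b F) s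
      = pderiv a (pderiv b fun u => F (φ.symm u)) (φ s) := by
  refine pderiv_congr ?_
  filter_upwards [φ.open_target.mem_nhds (φ.map_source hs)] with v hv
  rw [surfDeriv, φ.right_inv hv]

theorem covDerivTangent_eq (a b : Fin 2) (i : Fin m) {s : S} (hs : s ∈ φ.source) :
    covDerivTangent gbar f φ ψ a b i s
      = covDeriv (ambientMetric gbar ψ) (localMap f φ ψ) a (velocity (localMap f φ ψ) b) (φ s) i := by
  rw [covDerivTangent, surfDeriv_surfDeriv _ _ _ hs]
  simp only [covDeriv, Pi.add_apply, connMatrix, mulVec, dotProduct, Matrix.of_apply,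
    Finset.sum_mul]
  congr 1
  rw [Finset.sum_comm]
  simp only [localMap, φ.left_inv hs]
  rfl

theorem nCoord_eq (A : Fin p) (i : Fin m) {s : S} (hs : s ∈ φ.source) :
    nCoord f ψ N A i s = localNormal ψ φ N A (φ s) i := by
  change chartComp ψ (f s) (N A s) i = chartComp ψ (f (φ.symm (φ s))) (N A (φ.symm (φ s))) i
  rw [φ.left_inv hs]

theorem secondFundamentalForm_eq (A : Fin p) {s : S} (hs : s ∈ φ.source) (a b : Fin 2) :
    secondFundamentalForm gbar f N φ ψ A s a b
      = covDeriv (ambientMetric gbar ψ) (localMap f φ ψ) a (velocity (localMap f φ ψ) b) (φ s)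
        ⬝ᵥ ambientMetric gbar ψ (localMap f φ ψ (φ s)) *ᵥ localNormal ψ φ N A (φ s) := by
  have hn : ∀ j, nCoord f ψ N A j s = localNormal ψ φ N A (φ s) j := fun j => nCoord_eq A j hs
  simp only [secondFundamentalForm, Matrix.of_apply, covDerivTangent_eq gbar _ _ _ hs, hn,
    dotProduct, mulVec, Finset.mul_sum, localMap, φ.left_inv hs]
  exact Finset.sum_congr rfl fun i _ => Finset.sum_congr rfl fun j _ => by ring

theorem tensorP_eq (ρ : Density S) (s : S) :
    tensorP ρ f φ ψ s = bivector (1 / ρ.coord φ (φ s))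
      (fun a => velocity (localMap f φ ψ) a (φ s)) (fun a => velocity (localMap f φ ψ) a (φ s)) := by
  ext i j
  simp only [tensorP, bivector, bracket, Matrix.of_apply, Matrix.smul_apply, Matrix.sub_apply,
    vecMulVec_apply, smul_eq_mul]
  rfl

/-- The Christoffel sum carries the same antisymmetrised derivatives of `X` as the bracket, so it
supplies the connection term of each covariant derivative of the normal. -/
theorem tensorS_eq (ρ : Density S) (A : Fin p) {s : S} (hs : s ∈ φ.source) :
    tensorS gbar ρ f N φ ψ A s = bivector (1 / ρ.coord φ (φ s))
      (fun a => velocity (localMap f φ ψ) a (φ s))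
      (fun a => covDeriv (ambientMetric gbar ψ) (localMap f φ ψ) a (localNormal ψ φ N A) (φ s)) := by
  have hn : ∀ j, nCoord f ψ N A j s = localNormal ψ φ N A (φ s) j := fun j => nCoord_eq A j hs
  have hX : localMap f φ ψ (φ s) = ψ (f s) := by rw [localMap, φ.left_inv hs]
  have hx : ∀ a i, surfDeriv φ a (xCoord f ψ i) s = velocity (localMap f φ ψ) a (φ s) i :=
    fun a i => rfl
  have hd : ∀ a j, surfDeriv φ a (nCoord f ψ N A j) s
      = pderivVec a (localNormal ψ φ N A) (φ s) j := fun a j => rfl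
  ext i j
  have hc : ∀ a, covDeriv (ambientMetric gbar ψ) (localMap f φ ψ) a (localNormal ψ φ N A) (φ s) j
      = pderivVec a (localNormal ψ φ N A) (φ s) j
        + ∑ k, ∑ l, christoffel (ambientMetric gbar ψ) j k l (ψ (f s))
          * velocity (localMap f φ ψ) a (φ s) k * localNormal ψ φ N A (φ s) l := by
    intro a
    rw [Finset.sum_comm]
    simp only [covDeriv, Pi.add_apply, connMatrix, mulVec, dotProduct, Matrix.of_apply,
      Finset.sum_mul, hX]
  simp only [tensorS, bivector, bracket, Matrix.of_apply, Matrix.smul_apply, Matrix.sub_apply,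
    vecMulVec_apply, smul_eq_mul, hc, hx, hd, hn]
  simp only [mul_add, mul_sub, Finset.mul_sum, sub_mul, Finset.sum_sub_distrib]
  -- Gives the summands on both sides one common order, so that the remaining sums match as atoms
  -- for `ring`.
  have hperm : ∀ c x V g n : ℝ, c * (x * V) * g * n = c * (x * (g * V * n)) := fun _ _ _ _ _ => by
    ring
  simp only [hperm]
  ring

end Surface

theorem det_fin_two_of_isSymm {g : Matrix (Fin 2) (Fin 2) ℝ} (hg : g.IsSymm) :
    g.det = g 0 0 * g 1 1 - g 0 1 ^ 2 := by
  rw [Matrix.det_fin_two, hg.apply 0 1]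
  ring

/-! ### The trace identities and the two curvature formulas -/

section Main

set_option linter.unusedSectionVars false

variable {p : ℕ} {r : ℕ∞ω}
  {S : Type*} [TopologicalSpace S] [ChartedSpace (Euc 2) S]
  {M : Type*} [TopologicalSpace M] [ChartedSpace (Euc (2 + p)) M] [IsManifold (𝓡 (2 + p)) ∞ M]
  {φ : OpenPartialHomeomorph S (Euc 2)} {ψ : OpenPartialHomeomorph M (Euc (2 + p))} {f : S → M}
  {U : Set S} {s : S} {gbar : Bundle.ContMDiffRiemannianMetric (𝓡 (2 + p)) r (Euc (2 + p))
      (fun x : M => TangentSpace (𝓡 (2 + p)) x)}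
  {N : Fin p → ∀ s : S, TangentSpace (𝓡 (2 + p)) (f s)}

theorem localNormal_orthonormal (hψ : ψ ∈ IsManifold.maximalAtlas (𝓡 (2 + p)) ∞ M)
    (hN : IsNormalFrame gbar f U N) {u : Euc 2} (hu : u ∈ localDomain f φ ψ U) (A B : Fin p) :
    localNormal ψ φ N A u ⬝ᵥ ambientMetric gbar ψ (localMap f φ ψ u) *ᵥ localNormal ψ φ N B u
      = if A = B then 1 else 0 := by
  rw [← hN.orthonormal _ hu.2.1, inner_eq_form gbar hψ hu.2.2]
  rfl

theorem localNormal_normal (hφ : φ ∈ IsManifold.maximalAtlas (𝓡 2) ∞ S)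
    (hψ : ψ ∈ IsManifold.maximalAtlas (𝓡 (2 + p)) ∞ M) (hf : ContMDiff (𝓡 2) (𝓡 (2 + p)) ∞ f)
    (hN : IsNormalFrame gbar f U N) {u : Euc 2} (hu : u ∈ localDomain f φ ψ U) (A : Fin p)
    (a : Fin 2) :
    localNormal ψ φ N A u ⬝ᵥ ambientMetric gbar ψ (localMap f φ ψ u)
      *ᵥ velocity (localMap f φ ψ) a u = 0 := by
  rw [← chartComp_tangentBasis hφ hψ hf hu]
  refine (inner_eq_form gbar hψ hu.2.2 _ _).symm.trans ?_
  rw [tangentBasis_eq hφ hf hu.1]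
  exact hN.normal _ hu.2.1 _ _

theorem mem_localDomain (hs : s ∈ φ.source ∩ U) (hfs : f s ∈ ψ.source) :
    φ s ∈ localDomain f φ ψ U := by
  refine ⟨φ.map_source hs.1, ?_⟩
  rw [Set.mem_preimage, φ.left_inv hs.1]
  exact ⟨hs.2, hfs⟩

theorem covDeriv_localNormal_form (hr : ∞ ≤ r) (hφ : φ ∈ IsManifold.maximalAtlas (𝓡 2) ∞ S)
    (hψ : ψ ∈ IsManifold.maximalAtlas (𝓡 (2 + p)) ∞ M) (hf : ContMDiff (𝓡 2) (𝓡 (2 + p)) ∞ f)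
    (hU : IsOpen U) (hN : IsNormalFrame gbar f U N) (hs : s ∈ φ.source ∩ U)
    (hfs : f s ∈ ψ.source) (A : Fin p) (a b : Fin 2) :
    covDeriv (ambientMetric gbar ψ) (localMap f φ ψ) a (localNormal ψ φ N A) (φ s)
        ⬝ᵥ ambientMetric gbar ψ (localMap f φ ψ (φ s)) *ᵥ velocity (localMap f φ ψ) b (φ s)
      = -secondFundamentalForm gbar f N φ ψ A s a b := by
  have hu := mem_localDomain hs hfs
  rw [secondFundamentalForm_eq gbar A hs.1]
  exact (isMetricAlong_localMap gbar hr hφ hψ hf hU).weingarten_equation hu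
    (contDiffAt_localNormal gbar hφ hψ hf hU hN hu A)
    (fun v hv a => localNormal_normal hφ hψ hf hN hv A a) a b

theorem secondFundamentalForm_symm (hr : ∞ ≤ r) (hφ : φ ∈ IsManifold.maximalAtlas (𝓡 2) ∞ S)
    (hψ : ψ ∈ IsManifold.maximalAtlas (𝓡 (2 + p)) ∞ M) (hf : ContMDiff (𝓡 2) (𝓡 (2 + p)) ∞ f)
    (hU : IsOpen U) (hs : s ∈ φ.source ∩ U) (hfs : f s ∈ ψ.source) (A : Fin p) (a b : Fin 2) :
    secondFundamentalForm gbar f N φ ψ A s a b = secondFundamentalForm gbar f N φ ψ A s b a := by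
  rw [secondFundamentalForm_eq gbar A hs.1, secondFundamentalForm_eq gbar A hs.1,
    (isMetricAlong_localMap gbar hr hφ hψ hf hU).covDeriv_velocity_comm (mem_localDomain hs hfs)]

/-- All pairings in the bivector trace are entries of -h_A; by symmetry they combine to h_{01}² +
h_{01}² - 2 h_{00} h_{11}. -/
theorem trace_mapS_sq (hr : ∞ ≤ r) (hφ : φ ∈ IsManifold.maximalAtlas (𝓡 2) ∞ S)
    (hψ : ψ ∈ IsManifold.maximalAtlas (𝓡 (2 + p)) ∞ M) (hf : ContMDiff (𝓡 2) (𝓡 (2 + p)) ∞ f)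
    (hU : IsOpen U) (hN : IsNormalFrame gbar f U N) (hs : s ∈ φ.source ∩ U)
    (hfs : f s ∈ ψ.source) (ρ : Density S) (A : Fin p) :
    (mapS gbar ρ f N φ ψ A s ^ 2).trace
      = -2 * (1 / ρ.coord φ (φ s)) ^ 2 * (secondFundamentalForm gbar f N φ ψ A s).det := by
  have hX : localMap f φ ψ (φ s) = ψ (f s) := by rw [localMap, φ.left_inv hs.1]
  have hw := covDeriv_localNormal_form hr hφ hψ hf hU hN hs hfs A
  rw [hX] at hw
  rw [pow_two, mapS, tensorS_eq gbar ρ A hs.1, trace_bivector_mul_bivector, Matrix.det_fin_two]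
  simp only [hw, secondFundamentalForm_symm hr hφ hψ hf hU hs hfs A 1 0]
  ring

/-- Half of the pairings are entries of `g`, the others entries of -h_A; the resulting combination
contracts h_A with the adjugate of `g`, that is, with det g times the inverse. -/
theorem trace_mapB (hr : ∞ ≤ r) (hφ : φ ∈ IsManifold.maximalAtlas (𝓡 2) ∞ S)
    (hψ : ψ ∈ IsManifold.maximalAtlas (𝓡 (2 + p)) ∞ M) (hf : ContMDiff (𝓡 2) (𝓡 (2 + p)) ∞ f)
    (himm : ∀ s, Function.Injective (mfderiv (𝓡 2) (𝓡 (2 + p)) f s))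
    (hU : IsOpen U) (hN : IsNormalFrame gbar f U N) (hs : s ∈ φ.source ∩ U)
    (hfs : f s ∈ ψ.source) (ρ : Density S) (A : Fin p) :
    (mapB gbar ρ f N φ ψ A s).trace = (1 / ρ.coord φ (φ s)) ^ 2
        * (inducedMetric gbar f φ (φ s)).det * (weingarten gbar f N φ ψ A s).trace := by
  have hu := mem_localDomain hs hfs
  have hX : localMap f φ ψ (φ s) = ψ (f s) := by rw [localMap, φ.left_inv hs.1]
  have hw := covDeriv_localNormal_form hr hφ hψ hf hU hN hs hfs A
  have hg : ∀ a b, velocity (localMap f φ ψ) a (φ s) ⬝ᵥ ambientMetric gbar ψ (ψ (f s))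
      *ᵥ velocity (localMap f φ ψ) b (φ s) = inducedMetric gbar f φ (φ s) a b := by
    intro a b
    rw [inducedMetric_eq_gram gbar hφ hψ hf hu, ← hX]
    rfl
  rw [hX] at hw
  have hdet := inducedMetric_det_ne_zero gbar hφ hf himm (φ.map_source hs.1)
  rw [mapB, mapP, mapS, tensorP_eq, tensorS_eq gbar ρ A hs.1, trace_bivector_mul_bivector,
    weingarten, trace_inv_mul_fin_two]
  simp only [hw, hg, (inducedMetric_isSymm gbar f φ (φ s)).apply 0 1]
  field_simp
  ring

theorem gaussianCurvature_eq (hr : ∞ ≤ r) (hφ : φ ∈ IsManifold.maximalAtlas (𝓡 2) ∞ S)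
    (hψ : ψ ∈ IsManifold.maximalAtlas (𝓡 (2 + p)) ∞ M) (hf : ContMDiff (𝓡 2) (𝓡 (2 + p)) ∞ f)
    (himm : ∀ s, Function.Injective (mfderiv (𝓡 2) (𝓡 (2 + p)) f s))
    (hU : IsOpen U) (hN : IsNormalFrame gbar f U N) (hs : s ∈ φ.source ∩ U)
    (hfs : f s ∈ ψ.source) (ρ : Density S) :
    gaussianCurvature gbar f φ s
      = 1 / (inducedMetric gbar f φ (φ s)).det
          * curvatureForm (ambientMetric gbar ψ) (ψ (f s))
              (fun i => surfDeriv φ 0 (xCoord f ψ i) s)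
              (fun i => surfDeriv φ 1 (xCoord f ψ i) s)
              (fun i => surfDeriv φ 1 (xCoord f ψ i) s)
              (fun i => surfDeriv φ 0 (xCoord f ψ i) s)
        - ρ.coord φ (φ s) ^ 2 / (2 * (inducedMetric gbar f φ (φ s)).det)
          * ∑ A, (mapS gbar ρ f N φ ψ A s ^ 2).trace := by
  have hu := mem_localDomain hs hfs
  have hX : localMap f φ ψ (φ s) = ψ (f s) := by rw [localMap, φ.left_inv hs.1]
  have hdet := inducedMetric_det_ne_zero gbar hφ hf himm (φ.map_source hs.1)
  have hρ := ρ.ne_zero φ hφ _ (φ.map_source hs.1)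
  have hmet := isMetricAlong_localMap gbar hr hφ hψ hf hU
  have hgram := fun v hv => inducedMetric_eq_gram gbar hφ hψ hf (u := v) (U := U) hv
  have hgauss := hmet.gauss_equation hgram hu rfl hdet
    (N := fun A => localNormal ψ φ N A (φ s)) (localNormal_orthonormal hψ hN hu)
    (localNormal_normal hφ hψ hf hN hu)
  have hsmooth : ∀ v ∈ localDomain f φ ψ U, ∀ a b,
      ContDiffAt ℝ ∞ (fun w => inducedMetric gbar f φ w a b) v := by
    intro v hv a b
    refine (hmet.contDiffAt_form hv (hmet.contDiffAt_velocity hv a)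
      (hmet.contDiffAt_velocity hv b)).congr_of_eventuallyEq ?_
    filter_upwards [hmet.isOpen.mem_nhds hv] with w hw
    rw [hgram w hw]
    rfl
  -- The intrinsic curvature of the induced metric is the same `curvatureFirst` that appears in
  -- `hgauss`, so the two equations can be compared.
  have hK := curvatureForm_eq_curvatureFirst hmet.isOpen (inducedMetric_isSymm gbar f φ) hsmooth
    (fun v hv => inducedMetric_det_ne_zero gbar hφ hf himm hv.1) hu
  have hform : ∀ A, (secondFundamentalForm gbar f N φ ψ A s).det
      = secondFundamentalForm gbar f N φ ψ A s 1 1 * secondFundamentalForm gbar f N φ ψ A s 0 0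
        - secondFundamentalForm gbar f N φ ψ A s 0 1
          * secondFundamentalForm gbar f N φ ψ A s 1 0 := by
    intro A
    rw [Matrix.det_fin_two]
    ring
  simp only [← secondFundamentalForm_eq gbar _ hs.1, ← hform] at hgauss
  rw [hX] at hgauss
  rw [gaussianCurvature, ← det_fin_two_of_isSymm (inducedMetric_isSymm gbar f φ (φ s)), hK]
  simp only [trace_mapS_sq hr hφ hψ hf hU hN hs hfs ρ, ← Finset.mul_sum]
  -- The chart derivatives of the coordinates are the velocities by definition.
  change _ = _ * curvatureForm (ambientMetric gbar ψ) (ψ (f s)) (velocity (localMap f φ ψ) 0 (φ s))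
    (velocity (localMap f φ ψ) 1 (φ s)) (velocity (localMap f φ ψ) 1 (φ s))
    (velocity (localMap f φ ψ) 0 (φ s)) - _
  rw [hgauss]
  field_simp
  ring

theorem meanCurvatureVector_eq (hr : ∞ ≤ r) (hφ : φ ∈ IsManifold.maximalAtlas (𝓡 2) ∞ S)
    (hψ : ψ ∈ IsManifold.maximalAtlas (𝓡 (2 + p)) ∞ M) (hf : ContMDiff (𝓡 2) (𝓡 (2 + p)) ∞ f)
    (himm : ∀ s, Function.Injective (mfderiv (𝓡 2) (𝓡 (2 + p)) f s))
    (hU : IsOpen U) (hN : IsNormalFrame gbar f U N) (hs : s ∈ φ.source ∩ U)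
    (hfs : f s ∈ ψ.source) (ρ : Density S) :
    meanCurvatureVector gbar f N φ ψ s
      = (ρ.coord φ (φ s) ^ 2 / (2 * (inducedMetric gbar f φ (φ s)).det))
          • ∑ A, (mapB gbar ρ f N φ ψ A s).trace • N A s := by
  have hdet := inducedMetric_det_ne_zero gbar hφ hf himm (φ.map_source hs.1)
  have hρ := ρ.ne_zero φ hφ _ (φ.map_source hs.1)
  rw [meanCurvatureVector, Finset.smul_sum, Finset.smul_sum]
  refine Finset.sum_congr rfl fun A _ => ?_
  rw [trace_mapB hr hφ hψ hf himm hU hN hs hfs ρ, smul_smul, smul_smul]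
  congr 1
  field_simp

end Main

/-! ### The Euclidean case -/

section Flat

set_option linter.unusedSectionVars false
variable {m p : ℕ}

theorem refl_mem_maximalAtlas (m : ℕ) :
    OpenPartialHomeomorph.refl (Euc m) ∈ IsManifold.maximalAtlas (𝓡 m) ∞ (Euc m) :=
  (contDiffGroupoid ∞ (𝓡 m)).id_mem_maximalAtlas

theorem ambientMetric_flatMetric (y : Euc m) :
    ambientMetric (flatMetric m) (OpenPartialHomeomorph.refl (Euc m)) y = 1 := by
  have h : ∀ v : Euc m, (mfderiv (𝓡 m) (𝓡 m) (OpenPartialHomeomorph.refl (Euc m)).symm y v : Euc m)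
      = v := fun v => DFunLike.congr_fun (mfderiv_id (I := 𝓡 m) (x := y)) v
  ext i j
  have h1 : ambientMetric (flatMetric m) (OpenPartialHomeomorph.refl (Euc m)) y i j
      = inner ℝ (EuclideanSpace.single i 1 : Euc m) (EuclideanSpace.single j 1) :=
    congrArg₂ (fun v w : Euc m => (inner ℝ v w : ℝ)) (h _) (h _)
  have h2 : inner ℝ (EuclideanSpace.single i 1 : Euc m) (EuclideanSpace.single j 1 : Euc m)
      = (1 : Matrix (Fin m) (Fin m) ℝ) i j := by
    rw [EuclideanSpace.inner_single_left]
    simp [Matrix.one_apply]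
  exact h1.trans h2

theorem christoffel_const (A : Matrix (Fin m) (Fin m) ℝ) (i j k : Fin m) :
    christoffel (fun _ => A) i j k = fun _ => 0 := by
  ext y
  simp [christoffel, pderiv_const]

theorem curvatureForm_const (A : Matrix (Fin m) (Fin m) ℝ) (y : Euc m) (X Y Z W : Fin m → ℝ) :
    curvatureForm (fun _ => A) y X Y Z W = 0 := by
  simp [curvatureForm, riemann, christoffel_const, pderiv_const]

theorem ambientMetric_flatMetric_eq_const :
    ambientMetric (flatMetric m) (OpenPartialHomeomorph.refl (Euc m)) = fun _ => 1 :=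
  funext ambientMetric_flatMetric

variable {S : Type*} [TopologicalSpace S] [ChartedSpace (Euc 2) S]

theorem nCoord_refl (f : S → Euc m) (n : Fin p → S → Euc m) (A : Fin p) (i : Fin m) :
    nCoord f (OpenPartialHomeomorph.refl (Euc m)) (fun A s => (n A s : Euc m)) A i
      = fun t => n A t i := by
  ext t
  exact congrArg (fun w : Euc m => w i)
    (DFunLike.congr_fun (mfderiv_id (I := 𝓡 m) (x := f t)) (n A t))

/-- In the identity chart the metric matrix is constantly 1, so lowering an index changes nothing
and the Christoffel term vanishes. -/
theorem mapS_flatMetric (ρ : Density S) (f : S → Euc m) (n : Fin p → S → Euc m)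
    (φ : OpenPartialHomeomorph S (Euc 2)) (A : Fin p) (s : S) :
    mapS (flatMetric m) ρ f (fun A s => (n A s : Euc m)) φ (OpenPartialHomeomorph.refl (Euc m)) A s
      = Matrix.of fun i j => bracket ρ φ (fun t => f t i) (fun t => n A t j) s := by
  change tensorS (flatMetric m) ρ f (fun A s => (n A s : Euc m)) φ
    (OpenPartialHomeomorph.refl (Euc m)) A s * ambientMetric (flatMetric m) _ _ = _
  rw [ambientMetric_flatMetric, Matrix.mul_one]
  ext i j
  simp only [tensorS, ambientMetric_flatMetric_eq_const, christoffel_const, mul_zero, zero_mul,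
    Finset.sum_const_zero, add_zero, Matrix.of_apply, nCoord_refl]
  rfl

theorem mapP_flatMetric (ρ : Density S) (f : S → Euc m)
    (φ : OpenPartialHomeomorph S (Euc 2)) (s : S) :
    mapP (flatMetric m) ρ f φ (OpenPartialHomeomorph.refl (Euc m)) s
      = Matrix.of fun i j => bracket ρ φ (fun t => f t i) (fun t => f t j) s := by
  rw [mapP, ambientMetric_flatMetric, Matrix.mul_one]
  rfl

end Flat

end SurfaceCurvature
end

open SurfaceCurvature in
theorem theorem3p6 (p : ℕ)
    {S : Type*} [TopologicalSpace S] [ChartedSpace (Euc 2) S] [IsManifold (𝓡 2) ∞ S]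
    (ρ : Density S) (φ : OpenPartialHomeomorph S (Euc 2))
    (hφ : φ ∈ IsManifold.maximalAtlas (𝓡 2) ∞ S)
    (U : Set S) (hU : IsOpen U) :
    (∀ (M : Type*) [TopologicalSpace M] [ChartedSpace (Euc (2 + p)) M]
      [IsManifold (𝓡 (2 + p)) ∞ M]
      (gbar : Bundle.ContMDiffRiemannianMetric (𝓡 (2 + p)) ∞ (Euc (2 + p))
        (fun x : M => TangentSpace (𝓡 (2 + p)) x))
      (f : S → M), ContMDiff (𝓡 2) (𝓡 (2 + p)) ∞ f →
      (∀ s, Function.Injective (mfderiv (𝓡 2) (𝓡 (2 + p)) f s)) →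
      ∀ N : Fin p → ∀ s : S, TangentSpace (𝓡 (2 + p)) (f s), IsNormalFrame gbar f U N →
      ∀ ψ ∈ IsManifold.maximalAtlas (𝓡 (2 + p)) ∞ M,
      ∀ s ∈ φ.source ∩ U, f s ∈ ψ.source →
        gaussianCurvature gbar f φ s
          = 1 / (inducedMetric gbar f φ (φ s)).det
              * curvatureForm (ambientMetric gbar ψ) (ψ (f s))
                  (fun i => surfDeriv φ 0 (xCoord f ψ i) s)
                  (fun i => surfDeriv φ 1 (xCoord f ψ i) s)
                  (fun i => surfDeriv φ 1 (xCoord f ψ i) s)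
                  (fun i => surfDeriv φ 0 (xCoord f ψ i) s)
            - ρ.coord φ (φ s) ^ 2 / (2 * (inducedMetric gbar f φ (φ s)).det)
              * ∑ A, (mapS gbar ρ f N φ ψ A s ^ 2).trace
        ∧ meanCurvatureVector gbar f N φ ψ s
          = (ρ.coord φ (φ s) ^ 2 / (2 * (inducedMetric gbar f φ (φ s)).det))
              • ∑ A, (mapB gbar ρ f N φ ψ A s).trace • N A s)
    ∧ (∀ f : S → Euc (2 + p), ContMDiff (𝓡 2) (𝓡 (2 + p)) ∞ f →
      (∀ s, Function.Injective (mfderiv (𝓡 2) (𝓡 (2 + p)) f s)) →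
      ∀ n : Fin p → S → Euc (2 + p),
      IsNormalFrame (flatMetric (2 + p)) f U (fun A s => (n A s : Euc (2 + p))) →
      ∀ s ∈ φ.source ∩ U,
        gaussianCurvature (flatMetric (2 + p)) f φ s
          = -(ρ.coord φ (φ s) ^ 2 / (2 * (inducedMetric (flatMetric (2 + p)) f φ (φ s)).det))
              * ∑ A, ∑ i, ∑ j, bracket ρ φ (fun t => f t i) (fun t => n A t j) s
                  * bracket ρ φ (fun t => f t j) (fun t => n A t i) s
        ∧ meanCurvatureVector (flatMetric (2 + p)) f (fun A s => (n A s : Euc (2 + p)))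
              φ (OpenPartialHomeomorph.refl (Euc (2 + p))) s
          = (ρ.coord φ (φ s) ^ 2 / (2 * (inducedMetric (flatMetric (2 + p)) f φ (φ s)).det))
              • ∑ A, (∑ i, ∑ j, bracket ρ φ (fun t => f t i) (fun t => f t j) s
                  * bracket ρ φ (fun t => f t j) (fun t => n A t i) s) • n A s) := by
  refine ⟨?_, ?_⟩
  · intro M _ _ _ gbar f hf himm N hN ψ hψ s hs hfs
    exact ⟨gaussianCurvature_eq le_rfl hφ hψ hf himm hU hN hs hfs ρ,
      meanCurvatureVector_eq le_rfl hφ hψ hf himm hU hN hs hfs ρ⟩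
  · intro f hf himm n hN s hs
    have hψ := refl_mem_maximalAtlas (2 + p)
    have hfs : f s ∈ (OpenPartialHomeomorph.refl (Euc (2 + p))).source := Set.mem_univ _
    constructor
    -- The flat metric has regularity `ω`, hence `le_top` in place of `le_rfl`; its curvature term
    -- is zero.
    · rw [gaussianCurvature_eq le_top hφ hψ hf himm hU hN hs hfs ρ,
        ambientMetric_flatMetric_eq_const, curvatureForm_const, mul_zero, zero_sub, neg_mul]
      simp only [mapS_flatMetric, pow_two (Matrix.of _), Matrix.trace, Matrix.diag_apply,
        Matrix.mul_apply, Matrix.of_apply]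
    · refine (meanCurvatureVector_eq le_top hφ hψ hf himm hU hN hs hfs ρ).trans ?_
      simp only [mapB, mapP_flatMetric, mapS_flatMetric, Matrix.trace, Matrix.diag_apply,
        Matrix.mul_apply, Matrix.of_apply]
      rfl
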